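/- **Setting.** Let $k\ge 1$ and ${\bf n}=(n_1,\dots,n_k)$ with integers $n_i\ge 1$. For a complex Hilbert space $\mathcal H$ and a tuple ${\bf X}=(X_1,\dots,X_k)$, $X_i=(X_{i,1},\dots,X_{i,n_i})$, of bounded operators on $\mathcal H$, put $\Phi_{X_i}(Y)=\sum_{j=1}^{n_i}X_{i,j}YX_{i,j}^*$. The regular polyball ${\bf B_n}(\mathcal H)$ consists of those ${\bf X}$ for which $X_{s,a}$ commutes with $X_{t,b}$ whenever $s\ne t$ and $$(id-\Phi_{X_1})^{p_1}\circ\cdots\circ(id-\Phi_{X_k})^{p_k}(I)\ge 0\quad\text{for all }p_1,\dots,p_k\in\{0,1\}.$$ Such an ${\bf X}$ is *pure* if $\Phi_{X_i}^{q}(I)\to 0$ in the weak operator topology as $q\to\infty$ for each $i$. Its defect is ${\bf \Delta_X}=(id-\Phi_{X_1})\circ\cdots\circ(id-\Phi_{X_k})(I)$, and $\operatorname{rank}({\bf X})$ is the rank of ${\bf \Delta_X}$. Tuples ${\bf X}$ on $\mathcal H$ and ${\bf Y}$ on $\mathcal H'$ are unitarily equivalent if there is a unitary $U:\mathcal H\to\mathcal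 H'$ with $UX_{i,j}=Y_{i,j}U$ for all $i,j$. Let $F^2(H_{n_i})$ be the full Fock space with orthonormal basis $e^i_\beta$ indexed by the words $\beta$ in the free semigroup $\mathbb F_{n_i}^+$ with generators $g^i_1,\dots,g^i_{n_i}$. Let $P^{(i)}_{q}$ be the orthogonal projection of $F^2(H_{n_i})$ onto the span of the $e^i_\beta$ with $|\beta|=q$, and let ${\bf S}_{i,j}=I\otimes\cdots\otimes S_{i,j}\otimes\cdots\otimes I$ on $F^2(H_{n_1})\otimes\cdots\otimes F^2(H_{n_k})$, where $S_{i,j}e^i_\beta=e^i_{g^i_j\beta}$ acts in the $i$-th factor. The Berezin kernel of ${\bf X}\in{\bf B_n}(\mathcal H)$ is the operator ${\bf K_X}:\mathcal H\to F^2(H_{n_1})\otimes\cdots\otimes F^2(H_{n_k})\otimes\overline{{\bf \Delta_X}\mathcal H}$, $${\bf K_X}h=\sum_{\beta_1,\dots,\beta_k}e^1_{\beta_1}\otimes\cdots\otimes e^k_{\beta_k}\otimes{\bf \Delta_X}^{1/2}X_{1,\beta_1}^*\cdots X_{k,\beta_k}^*h ,$$ where $X_{i,\beta}$ is the product of the operators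 $X_{i,j}$ along the word $\beta$. If ${\bf \Delta_X}$ is of trace class, the curvature of ${\bf X}$ is $$\operatorname{curv}({\bf X})=\lim_{m\to\infty}\frac1{\binom{m+k}{k}}\sum_{q_1+\cdots+q_k\le m}\frac{\operatorname{trace}\left[{\bf K_X^*}(P^{(1)}_{q_1}\otimes\cdots\otimes P^{(k)}_{q_k}\otimes I){\bf K_X}\right]}{\operatorname{trace}\left[P^{(1)}_{q_1}\otimes\cdots\otimes P^{(k)}_{q_k}\right]},$$ and the multiplicity of a closed subspace $\mathcal N$ of $F^2(H_{n_1})\otimes\cdots\otimes F^2(H_{n_k})$ invariant under all ${\bf S}_{i,j}$, with orthogonal projection $P_{\mathcal N}$, is $$m(\mathcal N)=\lim_{m\to\infty}\frac1{\binom{m+k}{k}}\sum_{q_1+\cdots+q_k\le m}\frac{\operatorname{trace}\left[P_{\mathcal N}(P^{(1)}_{q_1}\otimes\cdots\otimes P^{(k)}_{q_k})\right]}{\operatorname{trace}\left[P^{(1)}_{q_1}\otimes\cdots\otimes P^{(k)}_{q_k}\right]}.$$ **Theorem.** 1. If $n_i\ge 2$ and $n_j\ge 2$ for some $i\ne j$,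 then for each $t\in(0,1)$ there is an uncountable family $\{T^{(\omega)}(t)\}_{\omega\in\Omega}$ of pure elements of regular polyballs ${\bf B_n}(\mathcal H_\omega)$ such that $T^{(\omega)}(t)$ is not unitarily equivalent to $T^{(\sigma)}(t)$ whenever $\omega\ne\sigma$, and $\operatorname{rank}[T^{(\omega)}(t)]=1$ and $\operatorname{curv}[T^{(\omega)}(t)]=t$ for all $\omega\in\Omega$. 2. If $n_i\ge 2$ for at least one $i$, then for each $t\in[0,1]$ there are a Hilbert space $\mathcal H$ and a pure element ${\bf T}\in{\bf B_n}(\mathcal H)$ with $\operatorname{rank}({\bf T})=1$ and $\operatorname{curv}({\bf T})=t$; and for each $s\in[0,1]$ there is a closed subspace $\mathcal N$ of $F^2(H_{n_1})\otimes\cdots\otimes F^2(H_{n_k})$, invariant under all ${\bf S}_{i,j}$, with $m(\mathcal N)=s$. -/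

import Mathlib

/-! # Polyballs, Berezin kernels, curvature and multiplicity

Throughout, `n = (n₁, …, n_k)` is given as `n : Fin k → ℕ`, and inner products are conjugate-linear
in the first variable. -/

namespace Polyball

noncomputable section

open Filter Topology
open scoped InnerProductSpace

universe u v

/-! ### Trace-class operators -/

section Trace

variable {H : Type u} [NormedAddCommGroup H] [InnerProductSpace ℂ H]

/-- `A` is of trace class with trace `c`: for every orthonormal basis `b` of the complex Hilbert
space `H` the series `∑ ⟨A b_i, b_i⟩` converges unconditionally, with sum `c`. -/
def HasTrace (A : H →L[ℂ] H) (c : ℂ) : Prop :=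
  ∀ (ι : Type u) (b : HilbertBasis ι ℂ H), HasSum (fun i => ⟪b i, A (b i)⟫_ℂ) c

/-- `A` is a trace-class operator. -/
def IsTraceClass (A : H →L[ℂ] H) : Prop := ∃ c, HasTrace A c

open Classical in
/-- The trace of a trace-class operator (and `0` for operators that are not of trace class). -/
def opTrace (A : H →L[ℂ] H) : ℂ := if h : IsTraceClass A then h.choose else 0

end Trace

/-! ### Full Fock spaces, their tensor product, and the universal model -/

section Fock

variable {k : ℕ} (n : Fin k → ℕ)

/-- `k`-tuples `(β₁, …, β_k)` of words, `β_i` in the unital free semigroup on `n_i` generators. -/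
abbrev Words : Type := ∀ i : Fin k, FreeMonoid (Fin (n i))

/-- The Hilbert space `F²(H_{n₁}) ⊗ ⋯ ⊗ F²(H_{n_k}) ⊗ E`, realized through the orthonormal basis
`e_{β₁} ⊗ ⋯ ⊗ e_{β_k}` as the space of square-summable families of vectors of `E` indexed by
`Words n`. For `E = ℂ` it is `F²(H_{n₁}) ⊗ ⋯ ⊗ F²(H_{n_k})`. -/
abbrev Fock (E : Type v) [NormedAddCommGroup E] : Type v := lp (fun _ : Words n => E) 2

variable {n} (E : Type v) [NormedAddCommGroup E] [InnerProductSpace ℂ E]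

open Classical in
/-- The isometric embedding `x ↦ e_{β₁} ⊗ ⋯ ⊗ e_{β_k} ⊗ x`. -/
def basisTensor (β : Words n) : E →ₗᵢ[ℂ] Fock n E where
  toLinearMap := lp.lsingle (E := fun _ : Words n => E) (𝕜 := ℂ) 2 β
  norm_map' x := lp.norm_single (E := fun _ : Words n => E) (p := 2) (by norm_num) β x

theorem basisTensor_apply_self (β : Words n) (x : E) : basisTensor E β x β = x := by
  classical
  exact lp.single_apply_self (E := fun _ : Words n => E) 2 β x

theorem basisTensor_apply_ne {β γ : Words n} (h : γ ≠ β) (x : E) : basisTensor E β x γ = 0 := by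
  classical
  exact lp.single_apply_ne (E := fun _ : Words n => E) 2 β x h

/-- Multiplication on the left of the `i`-th word by the `j`-th generator. -/
def consWord (i : Fin k) (j : Fin (n i)) (β : Words n) : Words n :=
  Function.update β i (FreeMonoid.of j * β i)

theorem consWord_injective (i : Fin k) (j : Fin (n i)) :
    Function.Injective (consWord (n := n) i j) := by
  intro β γ h
  funext l
  have hl := congrFun h l
  by_cases hli : l = i
  · subst hli
    simpa [consWord] using hl
  · simpa [consWord, hli] using hl

theorem orthogonalFamily_basisTensor_comp {f : Words n → Words n} (hf : Function.Injective f) :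
    OrthogonalFamily ℂ (fun _ : Words n => E) (fun β => basisTensor E (f β)) := by
  classical
  intro β γ hβγ x y
  have h : f β ≠ f γ := fun h => hβγ (hf h)
  change ⟪lp.single (E := fun _ : Words n => E) 2 (f β) x, basisTensor E (f γ) y⟫_ℂ = 0
  rw [lp.inner_single_left, basisTensor_apply_ne E h, inner_zero_right]

variable [CompleteSpace E]

/-- The operator `𝐒_{i,j} ⊗ I_E`, with `𝐒_{i,j} = I ⊗ ⋯ ⊗ S_{i,j} ⊗ ⋯ ⊗ I` and `S_{i,j}` the left
creation operator: the isometry with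
`e_{β₁} ⊗ ⋯ ⊗ e_{β_i} ⊗ ⋯ ⊗ e_{β_k} ⊗ x ↦ e_{β₁} ⊗ ⋯ ⊗ e_{g_j β_i} ⊗ ⋯ ⊗ e_{β_k} ⊗ x`. -/
def creation (i : Fin k) (j : Fin (n i)) : Fock n E →L[ℂ] Fock n E :=
  (orthogonalFamily_basisTensor_comp E
    (consWord_injective i j)).linearIsometry.toContinuousLinearMap

theorem creation_basisTensor (i : Fin k) (j : Fin (n i)) (β : Words n) (x : E) :
    creation E i j (basisTensor E β x) = basisTensor E (consWord i j β) x := by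
  classical
  exact (orthogonalFamily_basisTensor_comp E
    (consWord_injective i j)).linearIsometry_apply_single (i := β) x

variable (n)

/-- The orthogonal projection `P_{q₁} ⊗ ⋯ ⊗ P_{q_k} ⊗ I_E` onto the closed span of the vectors
`e_{β₁} ⊗ ⋯ ⊗ e_{β_k} ⊗ x` with `|β_i| = q_i` for all `i`. -/
def homogeneousProj (q : Fin k → ℕ) : Fock n E →L[ℂ] Fock n E :=
  (Submodule.span ℂ {f : Fock n E | ∃ (β : Words n) (x : E),
    (∀ i, (β i).length = q i) ∧ f = basisTensor E β x}).topologicalClosure.starProjection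

end Fock

/-- The average `(m+k choose k)⁻¹ ∑_{q₁ + ⋯ + q_k ≤ m} a(q)` over multi-indices. -/
def simplexAverage {k : ℕ} (a : (Fin k → ℕ) → ℂ) (m : ℕ) : ℂ :=
  (((m + k).choose k : ℕ) : ℂ)⁻¹ *
    ∑ q ∈ (Fintype.piFinset fun _ : Fin k => Finset.range (m + 1)).filter
      (fun q => ∑ i, q i ≤ m), a q

/-! ### The regular polyball -/

section Tuples

variable {k : ℕ} {n : Fin k → ℕ}

variable (n) in
/-- Tuples `X = (X₁, …, X_k)` with `X_i = (X_{i,1}, …, X_{i,n_i})` of bounded operators on `H`. -/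
abbrev OperatorTuple (H : Type u) [NormedAddCommGroup H] [InnerProductSpace ℂ H] : Type u :=
  ∀ i : Fin k, Fin (n i) → (H →L[ℂ] H)

variable {H : Type u} [NormedAddCommGroup H] [InnerProductSpace ℂ H] [CompleteSpace H]

/-- The map `Φ_{X_i}(Y) = ∑_j X_{i,j} Y X_{i,j}^*` on bounded operators. -/
def cpMap (X : OperatorTuple n H) (i : Fin k) : Module.End ℂ (H →L[ℂ] H) :=
  ∑ j, LinearMap.mulLeftRight ℂ (X i j, star (X i j))

/-- The defect mapping `(id - Φ_{X₁})^{p₁} ∘ ⋯ ∘ (id - Φ_{X_k})^{p_k}`. -/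
def defectMap (X : OperatorTuple n H) (p : Fin k → ℕ) : Module.End ℂ (H →L[ℂ] H) :=
  (List.ofFn fun i => (1 - cpMap X i) ^ p i).prod

/-- The defect `(id - Φ_{X₁}) ∘ ⋯ ∘ (id - Φ_{X_k})(I)`. -/
def defect (X : OperatorTuple n H) : H →L[ℂ] H := defectMap X (fun _ => 1) 1

/-- Membership in the regular polyball `𝐁_n(H)`: operators with different first indices commute,
and `(id - Φ_{X₁})^{p₁} ∘ ⋯ ∘ (id - Φ_{X_k})^{p_k}(I) ≥ 0` whenever all `p_i ≤ 1`. -/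
structure IsPolyball (X : OperatorTuple n H) : Prop where
  commute : ∀ s t : Fin k, s ≠ t → ∀ a b, Commute (X s a) (X t b)
  nonneg : ∀ p : Fin k → ℕ, (∀ i, p i ≤ 1) → (defectMap X p 1).IsPositive

/-- Purity: `Φ_{X_i}^q(I) → 0` in the weak operator topology as `q → ∞`, for every `i`. -/
def IsPure (X : OperatorTuple n H) : Prop :=
  ∀ (i : Fin k) (x y : H), Tendsto (fun q : ℕ => ⟪x, ((cpMap X i ^ q) 1) y⟫_ℂ) atTop (𝓝 0)

/-- The rank of `X` is the rank of its defect. -/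
def rank (X : OperatorTuple n H) : Cardinal := LinearMap.rank (defect X : H →ₗ[ℂ] H)

/-- `X_{i,α} = X_{i,j₁} ⋯ X_{i,j_p}` for a word `α = g_{j₁} ⋯ g_{j_p}`, and `I` for the empty
word. -/
def wordOp (X : OperatorTuple n H) (i : Fin k) (α : FreeMonoid (Fin (n i))) : H →L[ℂ] H :=
  FreeMonoid.lift (X i) α

/-- The product `X_{1,β₁}^* ⋯ X_{k,β_k}^*`. -/
def wordsAdjoint (X : OperatorTuple n H) (β : Words n) : H →L[ℂ] H :=
  (List.ofFn fun i => star (wordOp X i (β i))).prod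

/-- The closure of the range of the defect. -/
abbrev defectSpace (X : OperatorTuple n H) : Submodule ℂ H :=
  (LinearMap.range (defect X : H →ₗ[ℂ] H)).topologicalClosure

/-- `K : H → F²(H_{n₁}) ⊗ ⋯ ⊗ F²(H_{n_k}) ⊗ D`, with `D` the defect space of `X`, is the
noncommutative Berezin kernel
`K h = ∑_β e_{β₁} ⊗ ⋯ ⊗ e_{β_k} ⊗ Δ^{1/2} X_{1,β₁}^* ⋯ X_{k,β_k}^* h`, with `Δ` the defect of `X`.
This determines the bounded operator `K`. -/
def IsBerezinKernel (X : OperatorTuple n H) (K : H →L[ℂ] Fock n (defectSpace X)) : Prop :=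
  ∀ (h : H) (β : Words n), ((K h β : defectSpace X) : H) = CFC.sqrt (defect X) (wordsAdjoint X β h)

/-- `X` has trace-class defect and its curvature exists and is equal to `c`: with the Berezin
kernel `K` of `X`, `c` is the limit as `m → ∞` of the averages over `q₁ + ⋯ + q_k ≤ m` of
`trace [K^* (P_{q₁} ⊗ ⋯ ⊗ P_{q_k} ⊗ I) K] / trace [P_{q₁} ⊗ ⋯ ⊗ P_{q_k}]`, where all the operators
are of trace class. -/
def HasCurvature (X : OperatorTuple n H) (c : ℝ) : Prop :=
  IsTraceClass (defect X) ∧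
  ∃ K : H →L[ℂ] Fock n (defectSpace X), IsBerezinKernel X K ∧
    (∀ q, IsTraceClass (ContinuousLinearMap.adjoint K ∘L homogeneousProj n (defectSpace X) q ∘L K)) ∧
    (∀ q, IsTraceClass (homogeneousProj n ℂ q)) ∧
    Tendsto (simplexAverage fun q =>
      opTrace (ContinuousLinearMap.adjoint K ∘L homogeneousProj n (defectSpace X) q ∘L K) /
        opTrace (homogeneousProj n ℂ q)) atTop (𝓝 (c : ℂ))

/-- `X` and `Y` are unitarily equivalent: some unitary operator `U : H → H'` satisfies
`U X_{i,j} = Y_{i,j} U` for all `i`, `j`. -/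
def UnitarilyEquivalent {H' : Type v} [NormedAddCommGroup H'] [InnerProductSpace ℂ H']
    (X : OperatorTuple n H) (Y : OperatorTuple n H') : Prop :=
  ∃ U : H ≃ₗᵢ[ℂ] H', ∀ (i : Fin k) (j : Fin (n i)) (x : H), U (X i j x) = Y i j (U x)

end Tuples

/-! ### Invariant subspaces and multiplicity -/

section Invariant

variable {k : ℕ} {n : Fin k → ℕ} {E : Type v} [NormedAddCommGroup E] [InnerProductSpace ℂ E]
  [CompleteSpace E]

/-- The closed subspace `N` of `F²(H_{n₁}) ⊗ ⋯ ⊗ F²(H_{n_k}) ⊗ E` is invariant under every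
`𝐒_{i,j} ⊗ I_E`. -/
def IsInvariant (N : ClosedSubmodule ℂ (Fock n E)) : Prop :=
  ∀ (i : Fin k) (j : Fin (n i)), ∀ f ∈ N, creation E i j f ∈ N

/-- The multiplicity of `N` exists and is equal to `c`: `c` is the limit as `m → ∞` of the averages
over `q₁ + ⋯ + q_k ≤ m` of
`trace [P_N (P_{q₁} ⊗ ⋯ ⊗ P_{q_k} ⊗ I_E)] / trace [P_{q₁} ⊗ ⋯ ⊗ P_{q_k}]`, where all the operators
are of trace class. -/
def HasMultiplicity (N : ClosedSubmodule ℂ (Fock n E)) (c : ℝ) : Prop :=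
  (∀ q, IsTraceClass (N.toSubmodule.starProjection ∘L homogeneousProj n E q)) ∧
  (∀ q, IsTraceClass (homogeneousProj n ℂ q)) ∧
  Tendsto (simplexAverage fun q =>
    opTrace (N.toSubmodule.starProjection ∘L homogeneousProj n E q) /
      opTrace (homogeneousProj n ℂ q)) atTop (𝓝 (c : ℂ))

end Invariant

end

end Polyball

namespace Polyball

noncomputable section

open Filter Topology
open scoped InnerProductSpace

universe u v

/-! ### Averages over simplices -/

section Averages

/-! Everything is monomial. Let `A` be a set of word tuples containing the empty tuple and closed
under deleting first letters. The span of the e_β with β ∈ A is coinvariant under the creation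
operators. For the compressed tuple, the iterates of Φ_{X_i} on I and the defect maps applied to I
are diagonal in the basis e_β (`ActsDiagonally`), with symbols 0 and 1. So positivity and purity are
read off these symbols, the defect is the projection onto e_1, and the Berezin kernel is the
inclusion x ↦ x ⊗ e_1. The quotient of traces in the curvature is therefore the density of `A` among
the tuples of lengths q (`hasTrace_modelKernel`), while the orthogonal complement of the span is
invariant and yields one minus that density.

To prescribe the density, read a word on n_i letters as an integer in base n_i, first letter least
significant, and keep the words of value at most τ_i n_i^length. Deleting the first letter preserves
this condition, and the proportion of words kept tends to τ_i. A product of such sets has limiting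
density ∏ τ_i, and averaging over simplices does not change the limit (`tendsto_simplexAverage`).

A unitary equivalence must match the vacuum vectors up to a scalar, hence the sets `A`
(`eq_of_unitarilyEquivalent`), and `A` determines τ_i as soon as n_i ≥ 2 (`eq_of_boundedTuples_eq`).
Two such indices leave a one-parameter choice of factorizations of t. -/

/-- The multi-indices `q` with `q₁ + ⋯ + q_k ≤ m`. -/
def simplexIndices (k m : ℕ) : Finset (Fin k → ℕ) :=
  (Fintype.piFinset fun _ : Fin k => Finset.range (m + 1)).filter (fun q => ∑ i, q i ≤ m)

theorem mem_simplexIndices {k m : ℕ} {q : Fin k → ℕ} :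
    q ∈ simplexIndices k m ↔ ∑ i, q i ≤ m := by
  simp only [simplexIndices, Finset.mem_filter, Fintype.mem_piFinset, Finset.mem_range,
    and_iff_right_iff_imp]
  intro h i
  have := Finset.single_le_sum (f := q) (fun _ _ => Nat.zero_le _) (Finset.mem_univ i)
  omega

/-- Slicing by the total degree s gives the multiset count `multichoose k s`; the sum over s ≤ m is
the hockey-stick identity. -/
theorem card_simplexIndices (k m : ℕ) : (simplexIndices k m).card = (m + k).choose k := by
  classical
  rw [← Nat.sum_range_multichoose, Finset.card_eq_sum_card_fiberwise (f := fun q => ∑ i, q i)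
    (t := Finset.range (m + 1))]
  · refine Finset.sum_congr rfl fun s hs => ?_
    have h := Finset.card_finsuppAntidiag_nat_eq_multichoose (s := (Finset.univ : Finset (Fin k))) s
    rw [Finset.card_fin] at h
    rw [← h]
    refine Finset.card_bij' (fun q _ => Finsupp.equivFunOnFinite.symm q) (fun f _ => ⇑f)
      ?_ ?_ ?_ ?_
    · intro q hq
      simp only [Finset.mem_filter] at hq
      simp [Finset.mem_finsuppAntidiag, hq.2]
    · intro f hf
      simp only [Finset.mem_finsuppAntidiag] at hf
      simp only [Finset.mem_filter, mem_simplexIndices, Finset.mem_range] at hs ⊢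
      have hf' : ∑ i, f i = s := hf.1
      omega
    · intro q _
      rfl
    · intro f _
      ext; rfl
  · intro q hq
    have := mem_simplexIndices.1 (Finset.mem_coe.1 hq)
    simp only [Finset.coe_range, Set.mem_Iio]
    omega

/-- Multi-indices with some entry smaller than `Q` are negligible in large simplices. -/
theorem card_simplexIndices_filter_lt (k m Q : ℕ) :
    ((simplexIndices k m).filter fun q => ∃ i, q i < Q).card * (m + 1) ≤
      k * Q * k.factorial * (m + k).choose k := by
  classical
  have h1 : ((simplexIndices k m).filter fun q => ∃ i, q i < Q) ⊆
      Finset.univ.biUnion fun i : Fin k => Fintype.piFinset fun l =>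
        if l = i then Finset.range Q else Finset.range (m + 1) := by
    intro q hq
    simp only [simplexIndices, Finset.mem_filter, Fintype.mem_piFinset] at hq
    obtain ⟨⟨hq, -⟩, i, hi⟩ := hq
    simp only [Finset.mem_biUnion, Finset.mem_univ, true_and, Fintype.mem_piFinset]
    refine ⟨i, fun l => ?_⟩
    by_cases hl : l = i
    · subst hl; simpa using hi
    · simpa [hl] using hq l
  have h2 : ∀ i : Fin k, (Fintype.piFinset fun l =>
      if l = i then Finset.range Q else Finset.range (m + 1)).card * (m + 1)
        = Q * (m + 1) ^ k := by
    intro i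
    rw [Fintype.card_piFinset, ← Finset.mul_prod_erase _ _ (Finset.mem_univ i)]
    rw [Finset.prod_congr rfl (g := fun _ => m + 1)
      (fun l hl => by simp [Finset.ne_of_mem_erase hl])]
    have : 0 < k := i.pos
    simp only [if_true, Finset.card_range, Finset.prod_const, Finset.card_erase_of_mem,
      Finset.mem_univ, Finset.card_fin]
    rw [mul_assoc, ← pow_succ, Nat.sub_add_cancel this]
  -- k! times the binomial is (m+1)⋯(m+k), and each of the k factors is at least m+1.
  have h3 : (m + 1) ^ k ≤ k.factorial * (m + k).choose k := by
    rw [← Nat.descFactorial_eq_factorial_mul_choose]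
    have := Nat.pow_sub_le_descFactorial (m + k) k
    rwa [show m + k + 1 - k = m + 1 by omega] at this
  calc _ ≤ (∑ i : Fin k, (Fintype.piFinset fun l =>
      if l = i then Finset.range Q else Finset.range (m + 1)).card) * (m + 1) := by
        gcongr
        exact (Finset.card_le_card h1).trans Finset.card_biUnion_le
    _ = k * (Q * (m + 1) ^ k) := by
        rw [Finset.sum_mul, Finset.sum_congr rfl fun i _ => h2 i]; simp
    _ ≤ k * (Q * (k.factorial * (m + k).choose k)) := by gcongr
    _ = _ := by ring

/-- Convergence along `atTop` controls `a q` only when all entries of `q` are large. The other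
indices form a share O(1/m) of the simplex, and boundedness makes their contribution vanish. -/
theorem tendsto_simplexAverage {k : ℕ} {a : (Fin k → ℕ) → ℂ} {c : ℂ} {M : ℝ}
    (hM : ∀ q, ‖a q‖ ≤ M) (ha : Tendsto a atTop (𝓝 c)) :
    Tendsto (simplexAverage a) atTop (𝓝 c) := by
  classical
  rw [Metric.tendsto_atTop] at ha ⊢
  intro ε hε
  obtain ⟨q₀, hq₀⟩ := ha (ε / 2) (by positivity)
  -- The sum dominates every coordinate of `q₀`, so a single threshold serves all entries.
  set Q := ∑ i, q₀ i with hQ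
  have hM0 : 0 ≤ M := (norm_nonneg _).trans (hM 0)
  -- `B / (m + 1)` bounds the contribution of the indices with a small entry to the average.
  set B : ℝ := (M + ‖c‖) * (k * Q * k.factorial) with hB
  have hB0 : 0 ≤ B := by positivity
  obtain ⟨m₀, hm₀⟩ := exists_nat_gt (B / (ε / 2))
  refine ⟨m₀, fun m hm => ?_⟩
  set C : ℝ := (((m + k).choose k : ℕ) : ℝ) with hC
  have hCpos : 0 < C := by
    rw [hC]; exact_mod_cast Nat.choose_pos (by omega)
  have hCc : (((m + k).choose k : ℕ) : ℂ) ≠ 0 := by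
    exact_mod_cast (Nat.choose_pos (by omega)).ne'
  have key : simplexAverage a m - c =
      (((m + k).choose k : ℕ) : ℂ)⁻¹ * ∑ q ∈ simplexIndices k m, (a q - c) := by
    rw [Finset.sum_sub_distrib, Finset.sum_const, card_simplexIndices, nsmul_eq_mul, mul_sub,
      inv_mul_cancel_left₀ hCc]
    rfl
  have hsum : ‖∑ q ∈ simplexIndices k m, (a q - c)‖ < ε * C := by
    rw [← Finset.sum_filter_add_sum_filter_not _ (fun q => ∃ i, q i < Q)]
    have hbad : ‖∑ q ∈ (simplexIndices k m).filter (fun q => ∃ i, q i < Q), (a q - c)‖ <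
        ε / 2 * C := by
      have h1 : ‖∑ q ∈ (simplexIndices k m).filter (fun q => ∃ i, q i < Q), (a q - c)‖ ≤
          ((simplexIndices k m).filter (fun q => ∃ i, q i < Q)).card * (M + ‖c‖) := by
        rw [← nsmul_eq_mul]
        exact (norm_sum_le _ _).trans (Finset.sum_le_card_nsmul _ _ _
          fun q _ => (norm_sub_le _ _).trans (by gcongr; exact hM q))
      have h2 : (((simplexIndices k m).filter (fun q => ∃ i, q i < Q)).card : ℝ) * (m + 1) ≤
          k * Q * k.factorial * C := by
        rw [hC]; exact_mod_cast card_simplexIndices_filter_lt k m Q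
      have h3 : B < ε / 2 * (m + 1) := by
        rw [div_lt_iff₀ (by positivity)] at hm₀
        have : (m₀ : ℝ) ≤ m := by exact_mod_cast hm
        nlinarith
      have hm1 : (0 : ℝ) < m + 1 := by positivity
      refine h1.trans_lt ?_
      refine lt_of_mul_lt_mul_right ?_ hm1.le
      calc _ = (M + ‖c‖) *
            (((simplexIndices k m).filter (fun q => ∃ i, q i < Q)).card * ((m : ℝ) + 1)) := by ring
        _ ≤ (M + ‖c‖) * (k * Q * k.factorial * C) := by gcongr
        _ = B * C := by rw [hB]; ring
        _ < ε / 2 * (m + 1) * C := by gcongr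
        _ = _ := by ring
    have hgood : ‖∑ q ∈ (simplexIndices k m).filter (fun q => ¬ ∃ i, q i < Q), (a q - c)‖ ≤
        ε / 2 * C := by
      refine (norm_sum_le _ _).trans ((Finset.sum_le_card_nsmul _ _ (ε / 2) ?_).trans ?_)
      · intro q hq
        simp only [Finset.mem_filter, not_exists, not_lt] at hq
        rw [← dist_eq_norm]
        refine (hq₀ q fun i => le_trans ?_ (hq.2 i)).le
        exact Finset.single_le_sum (f := q₀) (fun _ _ => Nat.zero_le _) (Finset.mem_univ i)
      · rw [nsmul_eq_mul, mul_comm]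
        gcongr
        rw [hC, ← card_simplexIndices]
        exact_mod_cast Finset.card_filter_le _ _
    calc _ ≤ _ := norm_add_le _ _
      _ < ε / 2 * C + ε / 2 * C := by linarith
      _ = ε * C := by ring
  rw [dist_eq_norm, key, norm_mul, norm_inv, Complex.norm_natCast, ← hC]
  rw [inv_mul_lt_iff₀ hCpos]
  linarith

end Averages

/-! ### Words and their values in base `d` -/

section WordValues

/-- The words of length `q` in `d` letters. -/
def wordsOfLength (d q : ℕ) : Finset (FreeMonoid (Fin d)) :=
  (Finset.univ : Finset (Fin q → Fin d)).map
    ⟨fun f => FreeMonoid.ofList (List.ofFn f), fun _ _ h => List.ofFn_injective h⟩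

theorem mem_wordsOfLength {d q : ℕ} {w : FreeMonoid (Fin d)} :
    w ∈ wordsOfLength d q ↔ w.length = q := by
  simp only [wordsOfLength, Finset.mem_map, Finset.mem_univ, true_and]
  constructor
  · rintro ⟨f, rfl⟩
    exact List.length_ofFn
  · rintro rfl
    exact ⟨fun i => w.toList.get i, List.ofFn_get _⟩

theorem card_wordsOfLength (d q : ℕ) : (wordsOfLength d q).card = d ^ q := by
  simp [wordsOfLength]

/-- The number with digits `w` in base `d`, the first letter being the least significant digit. -/
def wordValue {d : ℕ} (w : FreeMonoid (Fin d)) : ℕ :=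
  Nat.ofDigits d (w.toList.map Fin.val)

@[simp]
theorem wordValue_one {d : ℕ} : wordValue (1 : FreeMonoid (Fin d)) = 0 := rfl

theorem wordValue_of_mul {d : ℕ} (j : Fin d) (w : FreeMonoid (Fin d)) :
    wordValue (FreeMonoid.of j * w) = j + d * wordValue w := by
  simp [wordValue, Nat.ofDigits_cons]

theorem wordValue_lt {d : ℕ} (w : FreeMonoid (Fin d)) : wordValue w < d ^ w.length := by
  induction w using FreeMonoid.inductionOn' with
  | one => simp
  | of_mul j w ih =>
    rw [wordValue_of_mul, FreeMonoid.length_mul, FreeMonoid.length_of, pow_add, pow_one]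
    have := j.2
    nlinarith

theorem wordValue_injOn (d q : ℕ) :
    Set.InjOn (wordValue (d := d)) (wordsOfLength d q : Set (FreeMonoid (Fin d))) := by
  -- The induction needs only equal lengths, not a fixed one; the first digit is recovered modulo
  -- `d`.
  suffices h : ∀ w w' : FreeMonoid (Fin d), w.length = w'.length → wordValue w = wordValue w' →
      w = w' by
    intro w hw w' hw'
    rw [Finset.mem_coe, mem_wordsOfLength] at hw hw'
    exact h w w' (hw.trans hw'.symm)
  intro w
  induction w using FreeMonoid.inductionOn' with
  | one =>
    intro w' hl _
    exact (FreeMonoid.length_eq_zero.1 hl.symm).symm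
  | of_mul j w ih =>
    intro w' hl hv
    induction w' using FreeMonoid.inductionOn' with
    | one => simp at hl
    | of_mul j' w' _ =>
      have hd : 0 < d := j.pos
      simp only [FreeMonoid.length_mul, FreeMonoid.length_of, add_right_inj] at hl
      rw [wordValue_of_mul, wordValue_of_mul] at hv
      have h1 : (j : ℕ) = j' := by
        have := congrArg (· % d) hv
        simpa [Nat.add_mul_mod_self_left, Nat.mod_eq_of_lt j.2, Nat.mod_eq_of_lt j'.2] using this
      have h2 : wordValue w = wordValue w' := by
        rw [h1] at hv
        exact Nat.eq_of_mul_eq_mul_left hd (Nat.add_left_cancel hv)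
      rw [Fin.ext h1, ih w' hl h2]

/-- An injection of d^q words into the d^q integers below d^q is onto, so counting words becomes
counting integers. -/
theorem image_wordValue (d q : ℕ) :
    (wordsOfLength d q).image wordValue = Finset.range (d ^ q) := by
  refine Finset.eq_of_subset_of_card_le ?_ ?_
  · intro m hm
    obtain ⟨w, hw, rfl⟩ := Finset.mem_image.1 hm
    rw [← mem_wordsOfLength.1 hw]
    exact Finset.mem_range.2 (wordValue_lt w)
  · rw [Finset.card_image_of_injOn (wordValue_injOn d q), card_wordsOfLength, Finset.card_range]

/-- The words whose value, relative to the number of words of the same length, is at most `τ`. -/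
def boundedWords (d : ℕ) (τ : ℝ) : Set (FreeMonoid (Fin d)) :=
  {w | (wordValue w : ℝ) ≤ τ * (d : ℝ) ^ w.length}

theorem one_mem_boundedWords {d : ℕ} {τ : ℝ} (hτ : 0 ≤ τ) : 1 ∈ boundedWords d τ := by
  simpa [boundedWords] using hτ

/-- The deleted letter is the least significant digit: from j + d·v ≤ τ·d^(q+1) follows v ≤ τ·d^q.
This is why words are read with that digit first. -/
theorem mem_boundedWords_of_of_mul_mem {d : ℕ} {τ : ℝ} {j : Fin d} {w : FreeMonoid (Fin d)}
    (h : FreeMonoid.of j * w ∈ boundedWords d τ) : w ∈ boundedWords d τ := by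
  have hd : (0 : ℝ) < d := by exact_mod_cast j.pos
  simp only [boundedWords, Set.mem_ofPred_eq, wordValue_of_mul, FreeMonoid.length_mul,
    FreeMonoid.length_of, pow_add, pow_one, Nat.cast_add, Nat.cast_mul] at h ⊢
  have : (0 : ℝ) ≤ (j : ℕ) := Nat.cast_nonneg _
  refine le_of_mul_le_mul_left ?_ hd
  nlinarith

open Classical in
/-- The bounded words of length `q`. -/
def boundedWordsOfLength (d : ℕ) (τ : ℝ) (q : ℕ) : Finset (FreeMonoid (Fin d)) :=
  (wordsOfLength d q).filter (· ∈ boundedWords d τ)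

theorem card_boundedWordsOfLength_le (d : ℕ) (τ : ℝ) (q : ℕ) :
    (boundedWordsOfLength d τ q).card ≤ d ^ q := by
  rw [← card_wordsOfLength]
  classical exact Finset.card_filter_le _ _

theorem card_boundedWordsOfLength_eq (d : ℕ) (τ : ℝ) (q : ℕ) :
    (boundedWordsOfLength d τ q).card =
      ((Finset.range (d ^ q)).filter fun m : ℕ => (m : ℝ) ≤ τ * (d : ℝ) ^ q).card := by
  classical
  rw [← image_wordValue, Finset.filter_image, Finset.card_image_of_injOn]
  · congr 1
    refine Finset.filter_congr fun w hw => ?_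
    simp [boundedWords, mem_wordsOfLength.1 hw]
  · exact (wordValue_injOn d q).mono fun w hw => (Finset.mem_filter.1 hw).1

theorem le_card_boundedWordsOfLength {d : ℕ} {τ : ℝ} (hτ : τ ≤ 1) (q : ℕ) :
    τ * (d : ℝ) ^ q ≤ (boundedWordsOfLength d τ q).card := by
  rw [card_boundedWordsOfLength_eq]
  have h : Finset.range ⌈τ * (d : ℝ) ^ q⌉₊ ⊆
      (Finset.range (d ^ q)).filter fun m : ℕ => (m : ℝ) ≤ τ * (d : ℝ) ^ q := by
    intro m hm
    have hm' := Nat.lt_ceil.1 (Finset.mem_range.1 hm)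
    simp only [Finset.mem_filter, Finset.mem_range]
    refine ⟨?_, hm'.le⟩
    have : (m : ℝ) < (d : ℝ) ^ q :=
      hm'.trans_le (mul_le_of_le_one_left (by positivity) hτ)
    exact_mod_cast this
  have := Finset.card_le_card h
  rw [Finset.card_range] at this
  exact (Nat.le_ceil _).trans (by exact_mod_cast this)

theorem card_boundedWordsOfLength_le_add_one {d : ℕ} {τ : ℝ} (hτ : 0 ≤ τ) (q : ℕ) :
    ((boundedWordsOfLength d τ q).card : ℝ) ≤ τ * (d : ℝ) ^ q + 1 := by
  rw [card_boundedWordsOfLength_eq]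
  have h0 : 0 ≤ τ * (d : ℝ) ^ q := by positivity
  have h : (Finset.range (d ^ q)).filter (fun m : ℕ => (m : ℝ) ≤ τ * (d : ℝ) ^ q) ⊆
      Finset.range (⌊τ * (d : ℝ) ^ q⌋₊ + 1) := by
    intro m hm
    simp only [Finset.mem_filter] at hm
    exact Finset.mem_range.2 (Nat.lt_succ_of_le (Nat.le_floor hm.2))
  have := Finset.card_le_card h
  rw [Finset.card_range] at this
  calc _ ≤ ((⌊τ * (d : ℝ) ^ q⌋₊ + 1 : ℕ) : ℝ) := by exact_mod_cast this
    _ ≤ _ := by push_cast; gcongr; exact Nat.floor_le h0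

/-- The density of the bounded words among the words of length `q` tends to the bound. -/
theorem tendsto_density_boundedWords {d : ℕ} (hd : 1 ≤ d) {τ : ℝ} (hτ : τ ∈ Set.Icc (0 : ℝ) 1)
    (h1 : d = 1 → τ = 1) :
    Tendsto (fun q : ℕ => ((boundedWordsOfLength d τ q).card : ℝ) / (d : ℝ) ^ q) atTop (𝓝 τ) := by
  have hpos : ∀ q : ℕ, (0 : ℝ) < (d : ℝ) ^ q := fun q => by
    have : (0 : ℝ) < d := by exact_mod_cast hd
    positivity
  have hlow : ∀ q : ℕ, τ ≤ ((boundedWordsOfLength d τ q).card : ℝ) / (d : ℝ) ^ q := fun q => by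
    rw [le_div_iff₀ (hpos q)]
    exact le_card_boundedWordsOfLength hτ.2 q
  rcases hd.eq_or_lt with rfl | hd
  -- With one letter the error term d^(-q) used below does not decay; but then τ = 1 and every word
  -- is bounded, so the density is constantly 1.
  · refine tendsto_const_nhds.congr fun q => le_antisymm (hlow q) ?_
    rw [h1 rfl, div_le_one (hpos q)]
    exact_mod_cast card_boundedWordsOfLength_le 1 1 q
  · have hd' : (1 : ℝ) < d := by exact_mod_cast hd
    have hlim : Tendsto (fun q : ℕ => τ + ((d : ℝ)⁻¹) ^ q) atTop (𝓝 τ) := by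
      simpa using (tendsto_const_nhds (x := τ)).add
        (tendsto_pow_atTop_nhds_zero_of_lt_one (by positivity) (inv_lt_one_of_one_lt₀ hd'))
    refine tendsto_of_tendsto_of_tendsto_of_le_of_le tendsto_const_nhds hlim hlow fun q => ?_
    rw [div_le_iff₀ (hpos q), add_mul, inv_pow, inv_mul_cancel₀ (hpos q).ne']
    exact card_boundedWordsOfLength_le_add_one hτ.1 q

end WordValues

/-! ### Traces -/

section Trace

variable {H : Type u} [NormedAddCommGroup H] [InnerProductSpace ℂ H]

/-- Uniqueness of the trace needs an actual Hilbert basis to evaluate on, since `HasTrace`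
quantifies over all of them. -/
theorem opTrace_eq [CompleteSpace H] {A : H →L[ℂ] H} {c : ℂ} (h : HasTrace A c) :
    opTrace A = c := by
  have hA : IsTraceClass A := ⟨c, h⟩
  obtain ⟨w, b, -⟩ := exists_hilbertBasis ℂ H
  rw [opTrace, dif_pos hA]
  exact (hA.choose_spec w b).unique (h w b)

/-- An operator that is a finite sum of rank-one projections has trace the number of summands. -/
theorem hasTrace_card {ι : Type*} (s : Finset ι) (v : ι → H) (hv : ∀ i ∈ s, ‖v i‖ = 1)
    (A : H →L[ℂ] H) (hA : ∀ x, ⟪x, A x⟫_ℂ = ∑ i ∈ s, ⟪v i, x⟫_ℂ * ⟪x, v i⟫_ℂ) :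
    HasTrace A s.card := by
  intro κ b
  simp_rw [hA]
  have h : ((s.card : ℕ) : ℂ) = ∑ i ∈ s, ⟪v i, v i⟫_ℂ := by
    rw [Finset.sum_congr rfl fun i hi => by
      rw [inner_self_eq_norm_sq_to_K, hv i hi]]
    simp
  rw [h]
  -- Parseval's identity for each vector `v i`.
  exact hasSum_sum fun i _ => b.hasSum_inner_mul_inner (v i) (v i)

end Trace

/-! ### Coordinates on Fock spaces -/

section Fock

variable {k : ℕ} {n : Fin k → ℕ}

theorem consWord_apply_self (i : Fin k) (j : Fin (n i)) (β : Words n) :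
    consWord i j β i = FreeMonoid.of j * β i := by
  simp [consWord]

theorem consWord_apply_of_ne {i l : Fin k} (h : l ≠ i) (j : Fin (n i)) (β : Words n) :
    consWord i j β l = β l := by
  simp [consWord, h]

theorem consWord_apply_ne_one (i : Fin k) (j : Fin (n i)) (β : Words n) :
    consWord i j β i ≠ 1 := by
  rw [consWord_apply_self]
  intro h
  simpa using congrArg FreeMonoid.length h

theorem eq_of_consWord_eq {i : Fin k} {j j' : Fin (n i)} {β γ : Words n}
    (h : consWord i j β = consWord i j' γ) : j = j' := by
  have := congrArg FreeMonoid.toList (congrFun h i)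
  simp only [consWord_apply_self, FreeMonoid.toList_of_mul, List.cons.injEq] at this
  exact this.1

theorem consWord_comm {s t : Fin k} (h : s ≠ t) (a : Fin (n s)) (b : Fin (n t)) (β : Words n) :
    consWord s a (consWord t b β) = consWord t b (consWord s a β) := by
  simp only [consWord, Function.update_of_ne h, Function.update_of_ne h.symm]
  rw [Function.update_comm h]

theorem exists_eq_consWord {β : Words n} {i : Fin k} (h : β i ≠ 1) :
    ∃ (j : Fin (n i)) (γ : Words n), β = consWord i j γ := by
  cases hβ : β i using FreeMonoid.casesOn with
  | one => exact absurd hβ h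
  | of_mul j w =>
    refine ⟨j, Function.update β i w, ?_⟩
    simp [consWord, ← hβ]

/-- Induction on the total length of the tuple. -/
theorem words_induction {p : Words n → Prop} (one : p 1)
    (cons : ∀ i j β, p β → p (consWord i j β)) (β : Words n) : p β := by
  induction h : ∑ i, (β i).length using Nat.strong_induction_on generalizing β with
  | _ N ih =>
    by_cases hβ : ∀ i, β i = 1
    · rwa [show β = 1 from funext hβ]
    · push Not at hβ
      obtain ⟨i, hi⟩ := hβ
      obtain ⟨j, γ, rfl⟩ := exists_eq_consWord hi
      refine cons i j γ (ih _ ?_ γ rfl)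
      rw [← h]
      refine Finset.sum_lt_sum (fun l _ => ?_) ⟨i, Finset.mem_univ i, ?_⟩
      · by_cases hl : l = i
        · subst hl; simp [consWord_apply_self]
        · rw [consWord_apply_of_ne hl]
      · simp [consWord_apply_self]

/-- The tuples of words with prescribed lengths. -/
def wordsOfLengths (n : Fin k → ℕ) (q : Fin k → ℕ) : Finset (Words n) :=
  Fintype.piFinset fun i => wordsOfLength (n i) (q i)

theorem mem_wordsOfLengths {q : Fin k → ℕ} {β : Words n} :
    β ∈ wordsOfLengths n q ↔ ∀ i, (β i).length = q i := by
  simp [wordsOfLengths, mem_wordsOfLength]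

theorem fock_ext {E : Type v} [NormedAddCommGroup E] {f g : Fock n E} (h : ∀ β, f β = g β) :
    f = g :=
  lp.ext (funext h)

variable (E : Type v) [NormedAddCommGroup E] [InnerProductSpace ℂ E]

/-- The evaluation of an element of the Fock space at a coordinate. -/
def fockEval (β : Words n) : Fock n E →L[ℂ] E :=
  LinearMap.mkContinuous
    { toFun := fun f => f β
      map_add' := fun _ _ => rfl
      map_smul' := fun _ _ => rfl } 1 fun f => by
    rw [one_mul]
    exact lp.norm_apply_le_norm (by norm_num) f β

@[simp]
theorem fockEval_apply (β : Words n) (f : Fock n E) : fockEval E β f = f β := rfl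

theorem inner_basisTensor_left (β : Words n) (x : E) (f : Fock n E) :
    ⟪basisTensor E β x, f⟫_ℂ = ⟪x, f β⟫_ℂ := by
  classical
  exact lp.inner_single_left (𝕜 := ℂ) (G := fun _ : Words n => E) β x f

theorem inner_basisTensor_right (β : Words n) (x : E) (f : Fock n E) :
    ⟪f, basisTensor E β x⟫_ℂ = ⟪f β, x⟫_ℂ := by
  classical
  exact lp.inner_single_right (𝕜 := ℂ) (G := fun _ : Words n => E) β x f

theorem basisTensor_apply [DecidableEq (Words n)] (β γ : Words n) (x : E) :
    basisTensor E β x γ = if γ = β then x else 0 := by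
  split_ifs with h
  · rw [h, basisTensor_apply_self]
  · exact basisTensor_apply_ne E h x

variable {E}

variable [CompleteSpace E]

theorem adjoint_creation_apply (i : Fin k) (j : Fin (n i)) (f : Fock n E) (β : Words n) :
    ContinuousLinearMap.adjoint (creation E i j) f β = f (consWord i j β) := by
  refine ext_inner_left ℂ fun x => ?_
  rw [← inner_basisTensor_left, ContinuousLinearMap.adjoint_inner_right, creation_basisTensor,
    inner_basisTensor_left]

theorem creation_apply_consWord (i : Fin k) (j : Fin (n i)) (f : Fock n E) (β : Words n) :
    creation E i j f (consWord i j β) = f β := by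
  rw [← adjoint_creation_apply]
  have h : ContinuousLinearMap.adjoint (creation E i j) ∘L creation E i j = 1 :=
    LinearIsometry.adjoint_comp_self (orthogonalFamily_basisTensor_comp E
      (consWord_injective i j)).linearIsometry
  exact congrArg (fun g : Fock n E => g β) (DFunLike.congr_fun h f)

theorem creation_apply_of_forall_ne {i : Fin k} {j : Fin (n i)} {γ : Words n}
    (h : ∀ β, consWord i j β ≠ γ) (f : Fock n E) : creation E i j f γ = 0 := by
  classical
  refine ext_inner_left ℂ fun x => ?_
  rw [← inner_basisTensor_left, ← ContinuousLinearMap.adjoint_inner_left, inner_zero_right]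
  have : ContinuousLinearMap.adjoint (creation E i j) (basisTensor E γ x) = 0 := by
    refine fock_ext fun β => ?_
    rw [adjoint_creation_apply, basisTensor_apply_ne E (h β)]
    rfl
  rw [this, inner_zero_left]

/-- There are finitely many words of given lengths, so the sum is finite and lies in the span; the
remainder vanishes at those coordinates, hence is orthogonal to the generators. -/
theorem homogeneousProj_eq_sum (q : Fin k → ℕ) (f : Fock n E) :
    homogeneousProj n E q f = ∑ β ∈ wordsOfLengths n q, basisTensor E β (f β) := by
  classical
  refine Submodule.eq_starProjection_of_mem_orthogonal ?_ ?_
  · refine Submodule.le_topologicalClosure _ (Submodule.sum_mem _ fun β hβ => ?_)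
    exact Submodule.subset_span ⟨β, f β, mem_wordsOfLengths.1 hβ, rfl⟩
  · rw [Submodule.orthogonal_closure, Submodule.mem_orthogonal]
    intro u hu
    induction hu using Submodule.span_induction with
    | mem u hu =>
      obtain ⟨β, x, hβ, rfl⟩ := hu
      rw [inner_basisTensor_left]
      have : (f - ∑ β ∈ wordsOfLengths n q, basisTensor E β (f β)) β = 0 := by
        rw [← fockEval_apply, map_sub, map_sum]
        simp only [fockEval_apply, basisTensor_apply]
        rw [Finset.sum_ite_eq, if_pos (mem_wordsOfLengths.2 hβ), sub_self]
      rw [this, inner_zero_right]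
    | zero => exact inner_zero_left _
    | add x y _ _ hx hy => rw [inner_add_left, hx, hy, add_zero]
    | smul a x _ hx => rw [inner_smul_left, hx, mul_zero]

theorem norm_basisTensor_one (β : Words n) : ‖basisTensor ℂ β 1‖ = 1 := by
  rw [LinearIsometry.norm_map, norm_one]

theorem hasTrace_homogeneousProj (q : Fin k → ℕ) :
    HasTrace (homogeneousProj n ℂ q) ((wordsOfLengths n q).card : ℂ) := by
  refine hasTrace_card _ (fun β => basisTensor ℂ β 1) (fun β _ => norm_basisTensor_one β) _
    fun f => ?_
  rw [homogeneousProj_eq_sum, inner_sum]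
  refine Finset.sum_congr rfl fun β _ => ?_
  simp [inner_basisTensor_left, inner_basisTensor_right, Complex.mul_conj']

end Fock

/-! ### The compression of the universal model to a monomial coinvariant subspace -/

section Model

variable {k : ℕ} {n : Fin k → ℕ}

/-- A set of tuples of words that contains the empty tuple and is closed under deleting first
letters. -/
structure IsHereditary (A : Set (Words n)) : Prop where
  one_mem : (1 : Words n) ∈ A
  mem_of_consWord_mem : ∀ {i j β}, consWord i j β ∈ A → β ∈ A

/-- The closed span of the vectors `e_β`, `β ∈ A`, as an abstract Hilbert space. -/
abbrev ModelSpace (A : Set (Words n)) : Type := lp (fun _ : A => ℂ) 2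

variable {A : Set (Words n)}

open Classical in
/-- The coordinate of a vector at `e_β`, which is zero if `β ∉ A`. -/
def coord (x : ModelSpace A) (β : Words n) : ℂ := if h : β ∈ A then x ⟨β, h⟩ else 0

theorem coord_coe (x : ModelSpace A) (β : A) : coord x β = x β := by
  simp [coord]

theorem coord_of_notMem (x : ModelSpace A) {β : Words n} (h : β ∉ A) : coord x β = 0 := by
  simp [coord, h]

theorem modelSpace_ext {x y : ModelSpace A} (h : ∀ β ∈ A, coord x β = coord y β) : x = y :=
  lp.ext (funext fun β => by simpa only [coord_coe] using h β β.2)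

theorem coord_add (x y : ModelSpace A) (β : Words n) :
    coord (x + y) β = coord x β + coord y β := by
  by_cases h : β ∈ A <;> simp [coord, h]

theorem coord_sub (x y : ModelSpace A) (β : Words n) :
    coord (x - y) β = coord x β - coord y β := by
  by_cases h : β ∈ A <;> simp [coord, h]

theorem coord_smul (c : ℂ) (x : ModelSpace A) (β : Words n) :
    coord (c • x) β = c * coord x β := by
  by_cases h : β ∈ A <;> simp [coord, h]

theorem coord_zero (β : Words n) : coord (0 : ModelSpace A) β = 0 := by
  by_cases h : β ∈ A <;> simp [coord, h]

theorem coord_sum {ι : Type*} (s : Finset ι) (x : ι → ModelSpace A) (β : Words n) :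
    coord (∑ i ∈ s, x i) β = ∑ i ∈ s, coord (x i) β := by
  classical
  induction s using Finset.induction_on with
  | empty => simp [coord_zero]
  | insert i s hi ih => rw [Finset.sum_insert hi, Finset.sum_insert hi, coord_add, ih]

theorem inner_eq_tsum_coord (x y : ModelSpace A) :
    ⟪x, y⟫_ℂ = ∑' β : A, ⟪coord x β, coord y β⟫_ℂ := by
  rw [lp.inner_eq_tsum]
  simp only [coord_coe]

open Classical in
/-- The vector `e_β`, which is zero if `β ∉ A`. -/
def modelVec (A : Set (Words n)) (β : Words n) : ModelSpace A :=
  if h : β ∈ A then lp.single (E := fun _ : A => ℂ) 2 ⟨β, h⟩ 1 else 0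

theorem inner_modelVec_left (β : Words n) (x : ModelSpace A) :
    ⟪modelVec A β, x⟫_ℂ = coord x β := by
  classical
  by_cases h : β ∈ A
  · rw [modelVec, dif_pos h, lp.inner_single_left, coord, dif_pos h]
    simp
  · simp [modelVec, coord, h]

theorem inner_modelVec_right (β : Words n) (x : ModelSpace A) :
    ⟪x, modelVec A β⟫_ℂ = starRingEnd ℂ (coord x β) := by
  rw [← inner_conj_symm, inner_modelVec_left]

theorem norm_modelVec {β : Words n} (h : β ∈ A) : ‖modelVec A β‖ = 1 := by
  classical
  rw [modelVec, dif_pos h, lp.norm_single (by norm_num), norm_one]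

theorem coord_modelVec_self {β : Words n} (h : β ∈ A) : coord (modelVec A β) β = 1 := by
  rw [← inner_modelVec_left, inner_self_eq_norm_sq_to_K, norm_modelVec h]
  simp

theorem coord_modelVec_of_ne {β γ : Words n} (h : γ ≠ β) : coord (modelVec A β) γ = 0 := by
  classical
  by_cases hβ : β ∈ A
  · by_cases hγ : γ ∈ A
    · rw [coord, dif_pos hγ, modelVec, dif_pos hβ]
      exact lp.single_apply_ne (E := fun _ : A => ℂ) 2 ⟨β, hβ⟩ 1 (by simpa using h)
    · exact coord_of_notMem _ hγ
  · rw [modelVec, dif_neg hβ, coord_zero]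

theorem modelVec_of_notMem {β : Words n} (h : β ∉ A) : modelVec A β = 0 := by
  simp [modelVec, h]

/-! ### Isometric embeddings of the model space into Fock spaces -/

section Embed

variable {E : Type v} [NormedAddCommGroup E] [InnerProductSpace ℂ E]

theorem orthogonalFamily_embed (A : Set (Words n)) {e : E} (he : ‖e‖ = 1) :
    OrthogonalFamily ℂ (fun _ : A => ℂ)
      (fun β => (basisTensor E (β : Words n)).comp (LinearIsometry.toSpanSingleton ℂ E he)) := by
  intro β γ hβγ x y
  have h : (β : Words n) ≠ γ := fun h => hβγ (Subtype.ext h)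
  change ⟪basisTensor E (β : Words n) (x • e), basisTensor E (γ : Words n) (y • e)⟫_ℂ = 0
  rw [inner_basisTensor_left, basisTensor_apply_ne E h, inner_zero_right]

variable [CompleteSpace E]

/-- The isometry `e_β ↦ e_{β₁} ⊗ ⋯ ⊗ e_{β_k} ⊗ e` for a unit vector `e`. -/
def embed (A : Set (Words n)) {e : E} (he : ‖e‖ = 1) : ModelSpace A →ₗᵢ[ℂ] Fock n E :=
  (orthogonalFamily_embed A he).linearIsometry

theorem embed_apply {e : E} (he : ‖e‖ = 1) (x : ModelSpace A) (γ : Words n) :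
    embed A he x γ = coord x γ • e := by
  classical
  have h : HasSum (fun β : A => basisTensor E (β : Words n) (x β • e) γ) (embed A he x γ) :=
    ((orthogonalFamily_embed A he).hasSum_linearIsometry x).mapL (fockEval E γ)
  refine h.unique ?_
  by_cases hγ : γ ∈ A
  · have hs := hasSum_single (f := fun β : A => basisTensor E (β : Words n) (x β • e) γ) ⟨γ, hγ⟩
      fun β hβ => basisTensor_apply_ne E (fun h => hβ (Subtype.ext h.symm)) _
    rw [basisTensor_apply_self] at hs
    rwa [coord, dif_pos hγ]
  · rw [coord_of_notMem _ hγ, zero_smul]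
    have : (fun β : A => basisTensor E (β : Words n) (x β • e) γ) = fun _ => 0 :=
      funext fun β => basisTensor_apply_ne E (fun h : γ = β => hγ (h ▸ β.2)) _
    rw [this]
    exact hasSum_zero

theorem embed_modelVec {e : E} (he : ‖e‖ = 1) {β : Words n} (h : β ∈ A) :
    embed A he (modelVec A β) = basisTensor E β e := by
  refine fock_ext fun γ => ?_
  rw [embed_apply]
  by_cases hγ : γ = β
  · rw [hγ, coord_modelVec_self h, basisTensor_apply_self, one_smul]
  · rw [coord_modelVec_of_ne hγ, basisTensor_apply_ne E hγ, zero_smul]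

end Embed

/-- The inclusion of the model space into the Fock space. -/
def modelInclusion (A : Set (Words n)) : ModelSpace A →L[ℂ] Fock n ℂ :=
  (embed A (e := (1 : ℂ)) norm_one).toContinuousLinearMap

theorem modelInclusion_apply (x : ModelSpace A) (γ : Words n) :
    modelInclusion A x γ = coord x γ :=
  (embed_apply norm_one x γ).trans (mul_one _)

theorem coord_adjoint_modelInclusion (f : Fock n ℂ) {β : Words n} (h : β ∈ A) :
    coord (ContinuousLinearMap.adjoint (modelInclusion A) f) β = f β := by
  rw [← inner_modelVec_left, ContinuousLinearMap.adjoint_inner_right]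
  have : modelInclusion A (modelVec A β) = basisTensor ℂ β 1 := embed_modelVec norm_one h
  rw [this, inner_basisTensor_left]
  simp

/-- The compression of the universal model to the closed span of the `e_β`, `β ∈ A`. -/
def modelTuple (A : Set (Words n)) : OperatorTuple n (ModelSpace A) := fun i j =>
  ContinuousLinearMap.adjoint (modelInclusion A) ∘L creation ℂ i j ∘L modelInclusion A

theorem coord_modelTuple_consWord {i : Fin k} {j : Fin (n i)} {β : Words n}
    (h : consWord i j β ∈ A) (x : ModelSpace A) :
    coord (modelTuple A i j x) (consWord i j β) = coord x β := by
  simp only [modelTuple, ContinuousLinearMap.comp_apply]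
  rw [coord_adjoint_modelInclusion _ h, creation_apply_consWord, modelInclusion_apply]

theorem coord_modelTuple_of_forall_ne {i : Fin k} {j : Fin (n i)} {γ : Words n}
    (h : ∀ β, consWord i j β ≠ γ) (x : ModelSpace A) : coord (modelTuple A i j x) γ = 0 := by
  by_cases hγ : γ ∈ A
  · simp only [modelTuple, ContinuousLinearMap.comp_apply]
    rw [coord_adjoint_modelInclusion _ hγ, creation_apply_of_forall_ne h]
  · exact coord_of_notMem _ hγ

/-- This is coinvariance: if `β` is outside a hereditary `A`, so is every tuple obtained from it by
adding a first letter, and both sides vanish. -/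
theorem coord_star_modelTuple (hA : IsHereditary A) (i : Fin k) (j : Fin (n i))
    (x : ModelSpace A) (β : Words n) :
    coord (star (modelTuple A i j) x) β = coord x (consWord i j β) := by
  by_cases hβ : β ∈ A
  · rw [ContinuousLinearMap.star_eq_adjoint, modelTuple, ContinuousLinearMap.adjoint_comp,
      ContinuousLinearMap.adjoint_comp, ContinuousLinearMap.adjoint_adjoint]
    simp only [ContinuousLinearMap.comp_apply]
    rw [coord_adjoint_modelInclusion _ hβ, adjoint_creation_apply, modelInclusion_apply]
  · rw [coord_of_notMem _ hβ, coord_of_notMem _ fun h => hβ (hA.mem_of_consWord_mem h)]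

theorem modelTuple_modelVec {i : Fin k} {j : Fin (n i)} {β : Words n} (hβ : β ∈ A) :
    modelTuple A i j (modelVec A β) = modelVec A (consWord i j β) := by
  refine modelSpace_ext fun γ hγ => ?_
  by_cases h : ∃ β', consWord i j β' = γ
  · obtain ⟨β', rfl⟩ := h
    rw [coord_modelTuple_consWord hγ]
    by_cases hb : β' = β
    · subst hb
      rw [coord_modelVec_self hβ, coord_modelVec_self hγ]
    · rw [coord_modelVec_of_ne hb, coord_modelVec_of_ne fun h => hb (consWord_injective i j h)]
  · push Not at h
    rw [coord_modelTuple_of_forall_ne h, coord_modelVec_of_ne (h β).symm]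

/-! ### Diagonal operators -/

/-- `D` multiplies every vector `e_β` by `f β`. -/
def ActsDiagonally (D : ModelSpace A →L[ℂ] ModelSpace A) (f : Words n → ℂ) : Prop :=
  ∀ x β, coord (D x) β = f β * coord x β

theorem actsDiagonally_one : ActsDiagonally (1 : ModelSpace A →L[ℂ] ModelSpace A) 1 := by
  intro x β
  simp

theorem ActsDiagonally.sub {D D' : ModelSpace A →L[ℂ] ModelSpace A} {f f' : Words n → ℂ}
    (h : ActsDiagonally D f) (h' : ActsDiagonally D' f') : ActsDiagonally (D - D') (f - f') := by
  intro x β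
  rw [sub_apply, coord_sub, h, h', Pi.sub_apply, sub_mul]

/-- Φ_{X_i} shifts a diagonal symbol by one letter in the `i`-th word. At a tuple whose `i`-th word
starts with the letter j, only the j-th summand survives; where that word is empty, none does. -/
theorem ActsDiagonally.cpMap (hA : IsHereditary A) {i : Fin k}
    {D : ModelSpace A →L[ℂ] ModelSpace A} {f f' : Words n → ℂ} (h : ActsDiagonally D f)
    (h1 : ∀ β, β i = 1 → f' β = 0) (h2 : ∀ j β, f' (consWord i j β) = f β) :
    ActsDiagonally (Polyball.cpMap (modelTuple A) i D) f' := by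
  intro x γ
  have hsum : Polyball.cpMap (modelTuple A) i D x =
      ∑ j, modelTuple A i j (D (star (modelTuple A i j) x)) := by
    simp [Polyball.cpMap, LinearMap.mulLeftRight_apply]
  rw [hsum, coord_sum]
  by_cases hγ : γ i = 1
  · rw [h1 γ hγ, zero_mul]
    refine Finset.sum_eq_zero fun j _ => coord_modelTuple_of_forall_ne (fun β hβ => ?_) _
    exact consWord_apply_ne_one i j β (by rw [hβ, hγ])
  · obtain ⟨j, β, rfl⟩ := exists_eq_consWord hγ
    by_cases hm : consWord i j β ∈ A
    · rw [Finset.sum_eq_single j, coord_modelTuple_consWord hm, h, coord_star_modelTuple hA, h2]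
      · intro j' _ hj'
        exact coord_modelTuple_of_forall_ne (fun β' hβ' => hj' (eq_of_consWord_eq hβ')) _
      · simp
    · rw [coord_of_notMem x hm, mul_zero]
      exact Finset.sum_eq_zero fun j' _ => coord_of_notMem _ hm

/-- A symbol with values 0 and 1 gives a self-adjoint idempotent. -/
theorem ActsDiagonally.isPositive {D : ModelSpace A →L[ℂ] ModelSpace A} {p : Words n → Prop}
    [DecidablePred p]
    (h : ActsDiagonally D fun β => if p β then 1 else 0) : D.IsPositive := by
  have hid : IsIdempotentElem D := by
    refine ContinuousLinearMap.ext fun x => modelSpace_ext fun β _ => ?_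
    rw [mul_apply_eq_comp, h, h]
    dsimp only
    split_ifs <;> simp
  rw [ContinuousLinearMap.IsIdempotentElem.isPositive_iff_isSelfAdjoint hid,
    ContinuousLinearMap.isSelfAdjoint_iff_isSymmetric]
  intro x y
  change ⟪D x, y⟫_ℂ = ⟪x, D y⟫_ℂ
  rw [inner_eq_tsum_coord, inner_eq_tsum_coord]
  refine tsum_congr fun β => ?_
  rw [h, h]
  dsimp only
  split_ifs <;> simp

-- Each factor id − Φ_{X_i} that occurs multiplies the symbol by the indicator of the `i`-th word
-- being empty.
open Classical in
theorem actsDiagonally_defectMap (hA : IsHereditary A) (p : Fin k → ℕ) (hp : ∀ i, p i ≤ 1) :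
    ActsDiagonally (defectMap (modelTuple A) p 1)
      fun β => if ∀ i, p i = 1 → β i = 1 then 1 else 0 := by
  have key : ∀ l : List (Fin k), l.Nodup →
      ActsDiagonally ((l.map fun i => (1 - cpMap (modelTuple A) i) ^ p i).prod 1)
        fun β => if ∀ i ∈ l, p i = 1 → β i = 1 then 1 else 0 := by
    intro l hl
    induction l with
    | nil => simpa using! actsDiagonally_one
    | cons i l ih =>
      obtain ⟨hil, hl⟩ := List.nodup_cons.1 hl
      specialize ih hl
      rw [List.map_cons, List.prod_cons, Module.End.mul_apply]
      rcases Nat.le_one_iff_eq_zero_or_eq_one.1 (hp i) with h0 | h1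
      · simpa [h0] using ih
      · rw [h1, pow_one, LinearMap.sub_apply, Module.End.one_apply]
        -- As `i ∉ l`, the symbol so far ignores the `i`-th word, so Φ_{X_i} merely multiplies it by
        -- the indicator of `β i ≠ 1`.
        have hcp := ih.cpMap hA (i := i)
          (f' := fun β => if β i = 1 then 0 else if ∀ i ∈ l, p i = 1 → β i = 1 then 1 else 0)
          (fun β hβ => if_pos hβ) fun j β => by
            rw [if_neg (consWord_apply_ne_one i j β)]
            refine if_congr (forall₂_congr fun m hm => ?_) rfl rfl
            rw [consWord_apply_of_ne fun h => hil (by rwa [h] at hm)]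
        convert ih.sub hcp using 1
        funext β
        by_cases hβ : β i = 1 <;> simp [hβ, h1]
  have := key (List.finRange k) (List.nodup_finRange k)
  simpa [defectMap, List.ofFn_eq_map] using this

theorem actsDiagonally_cpMap_pow (hA : IsHereditary A) (i : Fin k) (q : ℕ) :
    ActsDiagonally ((cpMap (modelTuple A) i ^ q) 1)
      fun β => if q ≤ (β i).length then 1 else 0 := by
  induction q with
  | zero => simpa using! actsDiagonally_one
  | succ q ih =>
    rw [pow_succ', Module.End.mul_apply]
    refine ih.cpMap hA (fun β hβ => by simp [hβ]) fun j β => ?_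
    simp [consWord_apply_self, add_comm 1]

theorem isPolyball_modelTuple (hA : IsHereditary A) : IsPolyball (modelTuple A) where
  commute s t hst a b := by
    -- The adjoints are easier: on coordinates they act by prepending letters, and letters prepended
    -- in different words commute.
    rw [← commute_star_star]
    refine ContinuousLinearMap.ext fun x => modelSpace_ext fun β _ => ?_
    simp only [mul_apply_eq_comp, coord_star_modelTuple hA]
    rw [consWord_comm hst]
  nonneg p hp := by
    classical
    have h := actsDiagonally_defectMap hA p hp
    exact h.isPositive

theorem ActsDiagonally.inner_eq_tsum {D : ModelSpace A →L[ℂ] ModelSpace A} {f : Words n → ℂ}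
    (h : ActsDiagonally D f) (x y : ModelSpace A) :
    ⟪x, D y⟫_ℂ = ∑' β : A, f β * ⟪coord x β, coord y β⟫_ℂ := by
  rw [inner_eq_tsum_coord]
  refine tsum_congr fun β => ?_
  rw [h, ← smul_eq_mul (f β), inner_smul_right]

/-- Φ_{X_i}^q(I) is the projection onto the tuples with |β_i| ≥ q; each fixed tuple eventually drops
out, and dominated convergence applies. -/
theorem isPure_modelTuple (hA : IsHereditary A) : IsPure (modelTuple A) := by
  intro i x y
  have hs : Summable fun β : A => ‖⟪coord x β, coord y β⟫_ℂ‖ := by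
    simp only [coord_coe]
    exact (lp.summable_inner (𝕜 := ℂ) x y).norm
  have key : Tendsto (fun q : ℕ => ∑' β : A,
      (if q ≤ ((β : Words n) i).length then 1 else 0) * ⟪coord x β, coord y β⟫_ℂ) atTop
      (𝓝 (∑' _ : A, 0)) := by
    refine tendsto_tsum_of_dominated_convergence hs (fun β => ?_)
      (Eventually.of_forall fun q β => ?_)
    · refine tendsto_const_nhds.congr' ?_
      filter_upwards [eventually_gt_atTop ((β : Words n) i).length] with q hq
      rw [if_neg (by omega), zero_mul]
    · split_ifs
      · rw [one_mul]
      · rw [zero_mul, norm_zero]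
        exact norm_nonneg _
  rw [tsum_zero] at key
  exact key.congr fun q => ((actsDiagonally_cpMap_pow hA i q).inner_eq_tsum x y).symm

/-! ### The defect and the Berezin kernel -/

theorem defect_modelTuple_apply (hA : IsHereditary A) (x : ModelSpace A) :
    defect (modelTuple A) x = coord x 1 • modelVec A 1 := by
  classical
  refine modelSpace_ext fun β _ => ?_
  rw [defect, actsDiagonally_defectMap hA _ (fun _ => le_rfl), coord_smul]
  by_cases h : β = 1
  · subst h
    simp [coord_modelVec_self hA.one_mem]
  · rw [coord_modelVec_of_ne h, mul_zero]
    dsimp only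
    rw [if_neg, zero_mul]
    exact fun h' => h (funext fun i => h' i rfl)

theorem defect_mul_self_modelTuple (hA : IsHereditary A) :
    defect (modelTuple A) * defect (modelTuple A) = defect (modelTuple A) := by
  refine ContinuousLinearMap.ext fun x => ?_
  rw [mul_apply_eq_comp, defect_modelTuple_apply hA, defect_modelTuple_apply hA,
    coord_smul, coord_modelVec_self hA.one_mem, mul_one]

theorem sqrt_eq_self_of_isIdempotentElem {H : Type u} [NormedAddCommGroup H]
    [InnerProductSpace ℂ H] [CompleteSpace H] {D : H →L[ℂ] H} (h : D * D = D)
    (hD : D.IsPositive) : CFC.sqrt D = D :=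
  CFC.sqrt_unique h ((ContinuousLinearMap.nonneg_iff_isPositive _).2 hD)

theorem isBerezinKernel_of_defect_mul_self {H : Type u} [NormedAddCommGroup H]
    [InnerProductSpace ℂ H] [CompleteSpace H] {X : OperatorTuple n H} (hX : IsPolyball X)
    (h : defect X * defect X = defect X) {K : H →L[ℂ] Fock n (defectSpace X)}
    (hK : ∀ x β, ((K x β : defectSpace X) : H) = defect X (wordsAdjoint X β x)) :
    IsBerezinKernel X K := by
  intro x β
  rw [sqrt_eq_self_of_isIdempotentElem h (hX.nonneg _ fun _ => le_rfl), hK]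

theorem defect_modelVec_one (hA : IsHereditary A) :
    defect (modelTuple A) (modelVec A 1) = modelVec A 1 := by
  rw [defect_modelTuple_apply hA, coord_modelVec_self hA.one_mem, one_smul]

theorem rank_modelTuple (hA : IsHereditary A) : rank (modelTuple A) = 1 := by
  have h : LinearMap.range (defect (modelTuple A) : ModelSpace A →ₗ[ℂ] ModelSpace A) =
      Submodule.span ℂ {modelVec A 1} := by
    refine le_antisymm ?_ ?_
    · rintro _ ⟨x, rfl⟩
      exact Submodule.mem_span_singleton.2 ⟨coord x 1, (defect_modelTuple_apply hA x).symm⟩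
    · rw [Submodule.span_singleton_le_iff_mem]
      exact ⟨modelVec A 1, defect_modelVec_one hA⟩
  have hne : modelVec A 1 ≠ 0 := by
    rw [← norm_ne_zero_iff, norm_modelVec hA.one_mem]
    exact one_ne_zero
  rw [rank, LinearMap.rank, h, ← Module.finrank_eq_rank, finrank_span_singleton hne, Nat.cast_one]

theorem coord_star_wordOp (hA : IsHereditary A) (i : Fin k) (α : FreeMonoid (Fin (n i)))
    (x : ModelSpace A) (γ : Words n) :
    coord (star (wordOp (modelTuple A) i α) x) γ = coord x (Function.update γ i (α * γ i)) := by
  induction α using FreeMonoid.inductionOn' generalizing x γ with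
  | one => simp [wordOp]
  | of_mul j w ih =>
    have : wordOp (modelTuple A) i (FreeMonoid.of j * w) =
        modelTuple A i j * wordOp (modelTuple A) i w := by simp [wordOp]
    rw [this, star_mul, mul_apply_eq_comp, ih, coord_star_modelTuple hA]
    simp [consWord, mul_assoc]

/-- The adjoints move the coordinate at β to the empty tuple, where the defect reads it. This
identifies the Berezin kernel with the inclusion. -/
theorem coord_wordsAdjoint (hA : IsHereditary A) (β : Words n) (x : ModelSpace A) :
    coord (wordsAdjoint (modelTuple A) β x) 1 = coord x β := by
  have key : ∀ l : List (Fin k), l.Nodup → ∀ γ : Words n,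
      coord ((l.map fun i => star (wordOp (modelTuple A) i (β i))).prod x) γ =
        coord x fun i => if i ∈ l then β i * γ i else γ i := by
    intro l hl
    induction l with
    | nil => intro γ; simp
    | cons i l ih =>
      intro γ
      obtain ⟨hil, hl⟩ := List.nodup_cons.1 hl
      rw [List.map_cons, List.prod_cons, mul_apply_eq_comp, coord_star_wordOp hA,
        ih hl]
      congr 1
      funext m
      by_cases hm : m = i
      · subst hm; simp [hil]
      · simp [hm]
  have := key (List.finRange k) (List.nodup_finRange k) 1
  simpa [wordsAdjoint, List.ofFn_eq_map] using! this

/-- The unit vector `e_1` of the defect space. -/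
def defectVec (hA : IsHereditary A) : defectSpace (modelTuple A) :=
  ⟨modelVec A 1, Submodule.le_topologicalClosure _ ⟨modelVec A 1, defect_modelVec_one hA⟩⟩

theorem norm_defectVec (hA : IsHereditary A) : ‖defectVec hA‖ = 1 :=
  norm_modelVec hA.one_mem

/-- The Berezin kernel of the compression. -/
def modelKernel (hA : IsHereditary A) :
    ModelSpace A →L[ℂ] Fock n (defectSpace (modelTuple A)) :=
  (embed A (norm_defectVec hA)).toContinuousLinearMap

theorem modelKernel_apply (hA : IsHereditary A) (x : ModelSpace A) (β : Words n) :
    modelKernel hA x β = coord x β • defectVec hA :=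
  embed_apply (norm_defectVec hA) x β

theorem isBerezinKernel_modelKernel (hA : IsHereditary A) :
    IsBerezinKernel (modelTuple A) (modelKernel hA) := by
  refine isBerezinKernel_of_defect_mul_self (isPolyball_modelTuple hA)
    (defect_mul_self_modelTuple hA) fun x β => ?_
  rw [modelKernel_apply, defect_modelTuple_apply hA, coord_wordsAdjoint hA]
  rfl

/-! ### Traces, curvature and multiplicity -/

theorem hasTrace_defect_modelTuple (hA : IsHereditary A) :
    HasTrace (defect (modelTuple A)) 1 := by
  have := hasTrace_card {(1 : Words n)} (modelVec A)
    (fun β hβ => by rw [Finset.mem_singleton.1 hβ, norm_modelVec hA.one_mem])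
    (defect (modelTuple A)) fun x => by
      rw [Finset.sum_singleton, defect_modelTuple_apply hA, inner_smul_right, inner_modelVec_left]
  simpa using this

-- The quadratic form of the operator at `x` is ∑ |x_β|² over the β ∈ A of lengths q, so the trace
-- counts these tuples.
open Classical in
theorem hasTrace_modelKernel (hA : IsHereditary A) (q : Fin k → ℕ) :
    HasTrace (ContinuousLinearMap.adjoint (modelKernel hA) ∘L
      homogeneousProj n (defectSpace (modelTuple A)) q ∘L modelKernel hA)
      (((wordsOfLengths n q).filter (· ∈ A)).card : ℂ) := by
  refine hasTrace_card _ (modelVec A) (fun β hβ => norm_modelVec (Finset.mem_filter.1 hβ).2) _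
    fun x => ?_
  simp only [ContinuousLinearMap.comp_apply]
  rw [ContinuousLinearMap.adjoint_inner_right, homogeneousProj_eq_sum, inner_sum,
    Finset.sum_filter]
  refine Finset.sum_congr rfl fun β _ => ?_
  rw [inner_basisTensor_right, modelKernel_apply, inner_smul_left, inner_smul_right,
    inner_self_eq_norm_sq_to_K, norm_defectVec, inner_modelVec_left, inner_modelVec_right]
  split_ifs with h
  · simp [mul_comm]
  · simp [coord_of_notMem x h]

open Classical in
/-- The proportion of the elements of `A` among the tuples of words of prescribed lengths. -/
def wordsDensity (A : Set (Words n)) (q : Fin k → ℕ) : ℝ :=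
  ((wordsOfLengths n q).filter (· ∈ A)).card / (wordsOfLengths n q).card

theorem wordsDensity_nonneg (A : Set (Words n)) (q : Fin k → ℕ) : 0 ≤ wordsDensity A q := by
  unfold wordsDensity; positivity

theorem wordsDensity_le_one (A : Set (Words n)) (q : Fin k → ℕ) : wordsDensity A q ≤ 1 := by
  classical
  refine div_le_one_of_le₀ ?_ (by positivity)
  exact_mod_cast Finset.card_filter_le _ _

theorem hasCurvature_modelTuple (hA : IsHereditary A) {c : ℝ}
    (h : Tendsto (wordsDensity A) atTop (𝓝 c)) : HasCurvature (modelTuple A) c := by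
  classical
  refine ⟨⟨1, hasTrace_defect_modelTuple hA⟩, modelKernel hA, isBerezinKernel_modelKernel hA,
    fun q => ⟨_, hasTrace_modelKernel hA q⟩, fun q => ⟨_, hasTrace_homogeneousProj q⟩, ?_⟩
  simp only [opTrace_eq (hasTrace_modelKernel hA _), opTrace_eq (hasTrace_homogeneousProj _)]
  have hq : (fun q => ((((wordsOfLengths n q).filter (· ∈ A)).card : ℕ) : ℂ) /
      ((wordsOfLengths n q).card : ℕ)) = fun q => ((wordsDensity A q : ℝ) : ℂ) := by
    funext q
    simp [wordsDensity]
  rw [hq]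
  refine tendsto_simplexAverage (M := 1) (fun q => ?_)
    ((Complex.continuous_ofReal.tendsto c).comp h)
  rw [Complex.norm_real, Real.norm_of_nonneg (wordsDensity_nonneg A q)]
  exact wordsDensity_le_one A q

/-- The closed span of the `e_β`, `β ∉ A`. -/
def complementSubspace (A : Set (Words n)) : ClosedSubmodule ℂ (Fock n ℂ) where
  carrier := {f | ∀ β ∈ A, f β = 0}
  add_mem' {f g} hf hg β hβ := by
    rw [lp.coeFn_add, Pi.add_apply, hf β hβ, hg β hβ, add_zero]
  zero_mem' _ _ := rfl
  smul_mem' c f hf β hβ := by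
    rw [lp.coeFn_smul, Pi.smul_apply, hf β hβ, smul_zero]
  isClosed' := by
    have : {f : Fock n ℂ | ∀ β ∈ A, f β = 0} = ⋂ β ∈ A, (fockEval ℂ β) ⁻¹' {0} := by
      ext f; simp
    change IsClosed {f : Fock n ℂ | ∀ β ∈ A, f β = 0}
    rw [this]
    exact isClosed_biInter fun β _ => isClosed_singleton.preimage (fockEval ℂ β).continuous

theorem mem_complementSubspace {f : Fock n ℂ} :
    f ∈ complementSubspace A ↔ ∀ β ∈ A, f β = 0 := Iff.rfl

theorem isInvariant_complementSubspace (hA : IsHereditary A) :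
    IsInvariant (complementSubspace A) := by
  intro i j f hf γ hγ
  by_cases h : ∃ β, consWord i j β = γ
  · obtain ⟨β, rfl⟩ := h
    rw [creation_apply_consWord]
    exact hf β (hA.mem_of_consWord_mem hγ)
  · push Not at h
    exact creation_apply_of_forall_ne h f

open Classical in
theorem starProjection_basisTensor (β : Words n) (c : ℂ) :
    (complementSubspace A).toSubmodule.starProjection (basisTensor ℂ β c) =
      if β ∈ A then 0 else basisTensor ℂ β c := by
  split_ifs with h
  · refine Submodule.eq_starProjection_of_mem_orthogonal (Submodule.zero_mem _) ?_
    rw [sub_zero, Submodule.mem_orthogonal]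
    intro f hf
    rw [inner_basisTensor_right, mem_complementSubspace.1 hf β h, inner_zero_left]
  · refine Submodule.eq_starProjection_of_mem_orthogonal ?_ ?_
    · exact fun γ hγ => basisTensor_apply_ne ℂ (fun h' : γ = β => h (h' ▸ hγ)) c
    · rw [sub_self]; exact Submodule.zero_mem _

open Classical in
theorem hasTrace_starProjection (A : Set (Words n)) (q : Fin k → ℕ) :
    HasTrace ((complementSubspace A).toSubmodule.starProjection ∘L homogeneousProj n ℂ q)
      (((wordsOfLengths n q).filter (· ∉ A)).card : ℂ) := by
  refine hasTrace_card _ (fun β => basisTensor ℂ β 1) (fun β _ => norm_basisTensor_one β) _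
    fun f => ?_
  rw [ContinuousLinearMap.comp_apply, homogeneousProj_eq_sum, map_sum, inner_sum,
    Finset.sum_filter]
  refine Finset.sum_congr rfl fun β _ => ?_
  rw [starProjection_basisTensor]
  by_cases h : β ∈ A
  · simp [h]
  · simp [h, inner_basisTensor_left, inner_basisTensor_right, Complex.mul_conj']

/-- Tuples in `A` and outside `A` have densities adding up to 1; `hn` keeps the number of tuples of
given lengths nonzero. -/
theorem hasMultiplicity_complementSubspace (hn : ∀ i, 1 ≤ n i) {c : ℝ}
    (h : Tendsto (wordsDensity A) atTop (𝓝 c)) :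
    HasMultiplicity (complementSubspace A) (1 - c) := by
  classical
  refine ⟨fun q => ⟨_, hasTrace_starProjection A q⟩, fun q => ⟨_, hasTrace_homogeneousProj q⟩, ?_⟩
  simp only [opTrace_eq (hasTrace_starProjection A _), opTrace_eq (hasTrace_homogeneousProj _)]
  have hq : (fun q => ((((wordsOfLengths n q).filter (· ∉ A)).card : ℕ) : ℂ) /
      ((wordsOfLengths n q).card : ℕ)) = fun q => ((1 - wordsDensity A q : ℝ) : ℂ) := by
    funext q
    have hpos : ((wordsOfLengths n q).card : ℂ) ≠ 0 := by
      rw [wordsOfLengths, Fintype.card_piFinset]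
      simp only [card_wordsOfLength]
      exact_mod_cast (Finset.prod_pos fun i _ => pow_pos (hn i) (q i)).ne'
    have hc : (((wordsOfLengths n q).filter (· ∈ A)).card : ℂ) +
        ((wordsOfLengths n q).filter (· ∉ A)).card = (wordsOfLengths n q).card := by
      exact_mod_cast Finset.card_filter_add_card_filter_not (s := wordsOfLengths n q) (· ∈ A)
    rw [wordsDensity]
    push_cast
    rw [← hc] at hpos ⊢
    field_simp
    ring
  rw [hq]
  refine tendsto_simplexAverage (M := 1) (fun q => ?_)
    ((Complex.continuous_ofReal.tendsto (1 - c)).comp (h.const_sub 1))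
  have h0 := wordsDensity_nonneg A q
  have h1 := wordsDensity_le_one A q
  rw [Complex.norm_real, Real.norm_of_nonneg (by linarith)]
  linarith

/-! ### Unitary equivalence -/

/-- Up to scalars, e_1 is the only vector orthogonal to the ranges of all the operators, so U e_1 =
c e_1. Applying the operators gives U e_β = c e_β by induction on β. -/
theorem subset_of_unitarilyEquivalent {A B : Set (Words n)} (hA : IsHereditary A)
    (hB : IsHereditary B) (h : UnitarilyEquivalent (modelTuple A) (modelTuple B)) : A ⊆ B := by
  obtain ⟨U, hU⟩ := h
  set c := coord (U (modelVec A 1)) 1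
  have h1 : U (modelVec A 1) = c • modelVec B 1 := by
    refine modelSpace_ext fun γ hγ => ?_
    rw [coord_smul]
    by_cases hγ1 : γ = 1
    · rw [hγ1, coord_modelVec_self hB.one_mem, mul_one]
    · rw [coord_modelVec_of_ne hγ1, mul_zero]
      obtain ⟨i, hi⟩ : ∃ i, γ i ≠ 1 := by
        by_contra! hcon
        exact hγ1 (funext hcon)
      obtain ⟨j, β, rfl⟩ := exists_eq_consWord hi
      -- A basis vector e_γ with γ ≠ 1 lies in the range of some `modelTuple B i j`; pulled back by
      -- `U`, it lies in the range of `modelTuple A i j`, which is orthogonal to e_1.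
      rw [← inner_modelVec_left, ← modelTuple_modelVec (hB.mem_of_consWord_mem hγ),
        ← U.apply_symm_apply (modelVec B β), ← hU, U.inner_map_map, inner_modelVec_right,
        coord_modelTuple_of_forall_ne, map_zero]
      exact fun β' h => consWord_apply_ne_one i j β' (by rw [h]; rfl)
  have key : ∀ β ∈ A, β ∈ B ∧ U (modelVec A β) = c • modelVec B β := by
    intro β
    induction β using words_induction with
    | one => exact fun _ => ⟨hB.one_mem, h1⟩
    | cons i j β ih =>
      intro hβ
      have hβA := hA.mem_of_consWord_mem hβ
      obtain ⟨hβB, hUβ⟩ := ih hβA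
      have heq : U (modelVec A (consWord i j β)) = c • modelVec B (consWord i j β) := by
        rw [← modelTuple_modelVec hβA, hU, hUβ, map_smul, modelTuple_modelVec hβB]
      refine ⟨?_, heq⟩
      by_contra hcon
      -- Outside `B` the vector e_β is zero by convention, contradicting that `U` is isometric.
      rw [modelVec_of_notMem hcon, smul_zero] at heq
      have := norm_modelVec hβ
      rw [← U.norm_map, heq, norm_zero] at this
      exact zero_ne_one this
  exact fun β hβ => (key β hβ).1

theorem UnitarilyEquivalent.symm {H : Type u} {H' : Type v} [NormedAddCommGroup H]
    [InnerProductSpace ℂ H] [CompleteSpace H] [NormedAddCommGroup H'] [InnerProductSpace ℂ H']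
    {X : OperatorTuple n H} {Y : OperatorTuple n H'} (h : UnitarilyEquivalent X Y) :
    UnitarilyEquivalent Y X := by
  obtain ⟨U, hU⟩ := h
  refine ⟨U.symm, fun i j x => ?_⟩
  rw [LinearIsometryEquiv.symm_apply_eq, hU, LinearIsometryEquiv.apply_symm_apply]

theorem eq_of_unitarilyEquivalent {A B : Set (Words n)} (hA : IsHereditary A)
    (hB : IsHereditary B) (h : UnitarilyEquivalent (modelTuple A) (modelTuple B)) : A = B :=
  (subset_of_unitarilyEquivalent hA hB h).antisymm
    (subset_of_unitarilyEquivalent hB hA h.symm)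

/-! ### Products of sets of bounded words -/

/-- The tuples of words with entries of relative value at most `τ i`. -/
def boundedTuples (n : Fin k → ℕ) (τ : Fin k → ℝ) : Set (Words n) :=
  {β | ∀ i, β i ∈ boundedWords (n i) (τ i)}

theorem isHereditary_boundedTuples {τ : Fin k → ℝ} (hτ : ∀ i, 0 ≤ τ i) :
    IsHereditary (boundedTuples n τ) where
  one_mem i := one_mem_boundedWords (hτ i)
  mem_of_consWord_mem {i j β} h l := by
    have hl := h l
    by_cases hli : l = i
    · subst hli
      rw [consWord_apply_self] at hl
      exact mem_boundedWords_of_of_mul_mem hl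
    · rwa [consWord_apply_of_ne hli] at hl

theorem wordsDensity_boundedTuples (τ : Fin k → ℝ) (q : Fin k → ℕ) :
    wordsDensity (boundedTuples n τ) q =
      ∏ i, ((boundedWordsOfLength (n i) (τ i) (q i)).card : ℝ) / (n i : ℝ) ^ q i := by
  classical
  have h : (wordsOfLengths n q).filter (· ∈ boundedTuples n τ) =
      Fintype.piFinset fun i => boundedWordsOfLength (n i) (τ i) (q i) := by
    ext β
    rw [Finset.mem_filter]
    simp [wordsOfLengths, boundedWordsOfLength, boundedTuples, forall_and]
  rw [wordsDensity, Finset.prod_div_distrib]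
  congr 1
  · rw [← Nat.cast_prod, ← Fintype.card_piFinset, ← h]
  · simp [wordsOfLengths, card_wordsOfLength]

theorem tendsto_wordsDensity_boundedTuples (hn : ∀ i, 1 ≤ n i) {τ : Fin k → ℝ}
    (hτ : ∀ i, τ i ∈ Set.Icc (0 : ℝ) 1) (h1 : ∀ i, n i = 1 → τ i = 1) :
    Tendsto (wordsDensity (boundedTuples n τ)) atTop (𝓝 (∏ i, τ i)) := by
  simp only [funext (wordsDensity_boundedTuples (n := n) τ)]
  refine tendsto_finsetProd _ fun i _ => ?_
  refine (tendsto_density_boundedWords (hn i) (hτ i) (h1 i)).comp (tendsto_atTop.2 fun b => ?_)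
  filter_upwards [eventually_ge_atTop fun _ => b] with q hq using hq i

/-- Putting empty words in the other positions recovers the `i`-th factor from the product, and its
limiting density is the threshold. -/
theorem eq_of_boundedTuples_eq {τ σ : Fin k → ℝ} (hτ : ∀ i, τ i ∈ Set.Icc (0 : ℝ) 1)
    (hσ : ∀ i, σ i ∈ Set.Icc (0 : ℝ) 1) (h : boundedTuples n τ = boundedTuples n σ)
    {i : Fin k} (hi : 2 ≤ n i) : τ i = σ i := by
  classical
  have hw : boundedWords (n i) (τ i) = boundedWords (n i) (σ i) := by
    have key : ∀ {ρ : Fin k → ℝ}, (∀ i, ρ i ∈ Set.Icc (0 : ℝ) 1) → ∀ w,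
        w ∈ boundedWords (n i) (ρ i) ↔ Function.update (1 : Words n) i w ∈ boundedTuples n ρ := by
      intro ρ hρ w
      constructor
      · intro hw l
        by_cases hl : l = i
        · subst hl; simpa using hw
        · simpa [hl] using one_mem_boundedWords (hρ l).1
      · intro hw
        simpa using hw i
    ext w
    rw [key hτ, key hσ, h]
  have hne : n i = 1 → τ i = 1 := by omega
  have hne' : n i = 1 → σ i = 1 := by omega
  refine tendsto_nhds_unique (tendsto_density_boundedWords (by omega) (hτ i) hne) ?_
  have := tendsto_density_boundedWords (by omega) (hσ i) hne'
  simpa only [boundedWordsOfLength, hw] using this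

end Model

end

end Polyball

/-! ### Choice of thresholds and proof of the theorem -/

theorem theorem3p7 (k : ℕ) (n : Fin k → ℕ) (hn : ∀ i, 1 ≤ n i) :
    -- two different indices with at least two generators: uncountable families
    ((∃ i j : Fin k, i ≠ j ∧ 2 ≤ n i ∧ 2 ≤ n j) →
      ∀ t ∈ Set.Ioo (0 : ℝ) 1,
        ∃ (Ω : Type) (_ : Uncountable Ω) (H : Ω → Type)
          (_ : ∀ ω, NormedAddCommGroup (H ω)) (_ : ∀ ω, InnerProductSpace ℂ (H ω))
          (_ : ∀ ω, CompleteSpace (H ω)) (T : ∀ ω, Polyball.OperatorTuple n (H ω)),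
          (∀ ω, Polyball.IsPolyball (T ω) ∧ Polyball.IsPure (T ω)) ∧
          (∀ ω σ, ω ≠ σ → ¬ Polyball.UnitarilyEquivalent (T ω) (T σ)) ∧
          (∀ ω, Polyball.rank (T ω) = 1 ∧ Polyball.HasCurvature (T ω) t)) ∧
    -- at least one index with at least two generators: ranges of curvature and multiplicity
    ((∃ i : Fin k, 2 ≤ n i) →
      (∀ t ∈ Set.Icc (0 : ℝ) 1,
        ∃ (H : Type) (_ : NormedAddCommGroup H) (_ : InnerProductSpace ℂ H)
          (_ : CompleteSpace H) (T : Polyball.OperatorTuple n H),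
          Polyball.IsPolyball T ∧ Polyball.IsPure T ∧ Polyball.rank T = 1 ∧
            Polyball.HasCurvature T t) ∧
      (∀ s ∈ Set.Icc (0 : ℝ) 1,
        ∃ N : ClosedSubmodule ℂ (Polyball.Fock n ℂ),
          Polyball.IsInvariant N ∧ Polyball.HasMultiplicity N s)) := by
  open Polyball in
  constructor
  · rintro ⟨i, j, hij, hi, hj⟩ t ⟨ht0, ht1⟩
    -- For t < s < 1 both s and t/s lie in (0, 1) and multiply to t; the parameter s is remembered
    -- by the `i`-th threshold. Indices with a single generator get threshold 1.
    set τ : Set.Ioo t 1 → Fin k → ℝ := fun s l =>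
      if l = i then (s : ℝ) else if l = j then t / s else 1 with hτdef
    have hs0 : ∀ s : Set.Ioo t 1, (0 : ℝ) < s := fun s => ht0.trans s.2.1
    have hτi : ∀ s, τ s i = s := fun s => by simp [hτdef]
    have hτj : ∀ s, τ s j = t / s := fun s => by simp [hτdef, hij.symm]
    have hτl : ∀ s l, l ≠ i → l ≠ j → τ s l = 1 := fun s l h h' => by simp [hτdef, h, h']
    have hτ : ∀ s l, τ s l ∈ Set.Icc (0 : ℝ) 1 := by
      intro s l
      by_cases h : l = i
      · rw [h, hτi]
        exact ⟨(hs0 s).le, s.2.2.le⟩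
      by_cases h' : l = j
      · rw [h', hτj]
        exact ⟨(div_pos ht0 (hs0 s)).le, (div_le_one (hs0 s)).2 s.2.1.le⟩
      · rw [hτl s l h h']
        exact ⟨zero_le_one, le_rfl⟩
    have h1 : ∀ s l, n l = 1 → τ s l = 1 := by
      intro s l hl
      refine hτl s l ?_ ?_ <;> rintro rfl <;> omega
    have hprod : ∀ s, ∏ l, τ s l = t := by
      intro s
      rw [Fintype.prod_eq_mul i j hij fun l hl => hτl s l hl.1 hl.2, hτi, hτj,
        mul_div_cancel₀ _ (hs0 s).ne']
    have hA : ∀ s, IsHereditary (boundedTuples n (τ s)) := fun s =>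
      isHereditary_boundedTuples fun l => (hτ s l).1
    refine ⟨Set.Ioo t 1, ?_, fun s => ModelSpace (boundedTuples n (τ s)), inferInstance,
      inferInstance, inferInstance, fun s => modelTuple (boundedTuples n (τ s)),
      fun s => ⟨isPolyball_modelTuple (hA s), isPure_modelTuple (hA s)⟩, ?_,
      fun s => ⟨rank_modelTuple (hA s), ?_⟩⟩
    · rw [← not_countable_iff]
      intro hc
      exact Cardinal.Real.Ioo_countable_iff.1 (Set.to_countable (Set.Ioo t 1)) |>.not_gt ht1
    · intro s s' hne he
      have := eq_of_boundedTuples_eq (hτ s) (hτ s') (eq_of_unitarilyEquivalent (hA s) (hA s') he) hi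
      rw [hτi, hτi] at this
      exact hne (Subtype.ext this)
    · refine hasCurvature_modelTuple (hA s) ?_
      rw [← hprod s]
      exact tendsto_wordsDensity_boundedTuples hn (hτ s) (h1 s)
  · rintro ⟨i, hi⟩
    have key : ∀ t ∈ Set.Icc (0 : ℝ) 1, ∃ A : Set (Words n), IsHereditary A ∧
        Filter.Tendsto (wordsDensity A) Filter.atTop (nhds t) := by
      intro t ht
      have hτ : ∀ l, (if l = i then t else 1) ∈ Set.Icc (0 : ℝ) 1 := by
        intro l
        split_ifs
        · exact ht
        · exact ⟨zero_le_one, le_rfl⟩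
      refine ⟨boundedTuples n fun l => if l = i then t else 1,
        isHereditary_boundedTuples fun l => (hτ l).1, ?_⟩
      have h := tendsto_wordsDensity_boundedTuples hn hτ fun l hl => by
        rw [if_neg]; rintro rfl; omega
      simpa using h
    refine ⟨fun t ht => ?_, fun s hs => ?_⟩
    · obtain ⟨A, hA, hlim⟩ := key t ht
      exact ⟨ModelSpace A, inferInstance, inferInstance, inferInstance, modelTuple A,
        isPolyball_modelTuple hA, isPure_modelTuple hA, rank_modelTuple hA,
        hasCurvature_modelTuple hA hlim⟩
    -- The invariant subspace is the complement, so density 1 − s gives multiplicity s.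
    · obtain ⟨A, hA, hlim⟩ := key (1 - s) ⟨by linarith [hs.2], by linarith [hs.1]⟩
      refine ⟨complementSubspace A, isInvariant_complementSubspace hA, ?_⟩
      simpa using hasMultiplicity_complementSubspace hn hlim
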